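/- Let $X \neq \{0\}$ be a real Hilbert space. A map $F\colon X\to X$ is called a \emph{neural operator layer} if $F(x)=x+T_2(G(T_1x))$ for all $x \in X$, where $T_1,T_2\colon X\to X$ are compact linear operators and $G\colon X\to X$ is continuously Fréchet differentiable; the layer is called \emph{bounded} if such a representation exists in which, in addition, $G$ and its derivative $DG$ are bounded on $X$ (so $G$ is also globally Lipschitz). $F$ is \emph{bilipschitz} if there are $c>0$ and $C<\infty$ with $c\|x_1-x_2\|\le\|F(x_1)-F(x_2)\|\le C\|x_1-x_2\|$ for all $x_1,x_2 \in X$, and \emph{strongly monotone} if there is $\alpha>0$ with $\langle F(x_1)-F(x_2),x_1-x_2\rangle\ge\alpha\|x_1-x_2\|^2$ for all $x_1,x_2 \in X$. A (nonlinear) map $B\colon X\to X$ is \emph{compact} if it is continuous and maps bounded sets to relatively compact sets; $\mathrm{Lip}(B)$ is its least Lipschitz constant on $X$. \textbf{Theorem.} There is $e\in X$ with $\|e\|=1$ such that the following holds for every bilipschitz neural operator layer $F\colon X\to X$ and every $r_1>0$. For every $\varepsilon>0$ there are a number $J=J(\varepsilon)$, an invertible linear map $A_0\colon X\to X$ that is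 either the identity or the reflection $x\mapsto x-2\langle x,e\rangle e$, and maps $H_k=\mathrm{Id}+B_k\colon X\to X$, $k=1,\dots,J$, such that each $H_k$ is strongly monotone and a bounded neural operator layer, each $B_k$ is compact with $\mathrm{Lip}(B_k)<\varepsilon$, and $$F(x)=H_J\circ\cdots\circ H_2\circ H_1\circ A_0(x)\qquad\text{for all } x\in X \text{ with } \|x\|<r_1 .$$ Moreover, the numbers $J(\varepsilon)$ can be chosen such that, if $F$ is twice continuously Fréchet differentiable on $X$, then $J(\varepsilon)=O(\varepsilon^{-2})$ as $\varepsilon\to0^+$, with a constant that may depend on $X$, $e$, $F$ and $r_1$ but not on $\varepsilon$. -/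

import Mathlib

open Filter Topology Asymptotics

/-- A (nonlinear) map `F : X → X` is strongly monotone. -/
def StronglyMonotoneMap {X : Type*} [NormedAddCommGroup X] [InnerProductSpace ℝ X]
    (F : X → X) : Prop :=
  ∃ α : ℝ, 0 < α ∧ ∀ x₁ x₂ : X, α * ‖x₁ - x₂‖ ^ 2 ≤ inner ℝ (F x₁ - F x₂) (x₁ - x₂)

/-- A map `F : X → X` is bilipschitz. -/
def BilipschitzMap {X : Type*} [NormedAddCommGroup X] (F : X → X) : Prop :=
  ∃ c C : ℝ, 0 < c ∧
    ∀ x₁ x₂ : X, c * ‖x₁ - x₂‖ ≤ ‖F x₁ - F x₂‖ ∧ ‖F x₁ - F x₂‖ ≤ C * ‖x₁ - x₂‖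

/-- A compact (nonlinear) map: continuous, and mapping bounded sets to relatively compact sets.
(Mathlib's `IsCompactOperator` has this meaning only for linear maps.) -/
def CompactMap {X : Type*} [NormedAddCommGroup X] (B : X → X) : Prop :=
  Continuous B ∧ ∀ s : Set X, Bornology.IsBounded s → IsCompact (closure (B '' s))

/-- A layer of a neural operator: `F x = x + T₂ (G (T₁ x))` with `T₁`, `T₂` compact linear operators
and `G` continuously Fréchet differentiable. -/
def NeuralOperatorLayer {X : Type*} [NormedAddCommGroup X] [InnerProductSpace ℝ X]
    (F : X → X) : Prop :=
  ∃ (T₁ T₂ : X →L[ℝ] X) (G : X → X),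
    IsCompactOperator T₁ ∧ IsCompactOperator T₂ ∧ ContDiff ℝ 1 G ∧
      ∀ x : X, F x = x + T₂ (G (T₁ x))

/-- A layer of a neural operator whose nonlinearity `G` is moreover bounded and has a bounded
derivative (so that `G` is also globally Lipschitz). -/
def BoundedNeuralOperatorLayer {X : Type*} [NormedAddCommGroup X] [InnerProductSpace ℝ X]
    (F : X → X) : Prop :=
  ∃ (T₁ T₂ : X →L[ℝ] X) (G : X → X),
    IsCompactOperator T₁ ∧ IsCompactOperator T₂ ∧ ContDiff ℝ 1 G ∧
      (∃ M : ℝ, ∀ x : X, ‖G x‖ ≤ M ∧ ‖fderiv ℝ G x‖ ≤ M) ∧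
      ∀ x : X, F x = x + T₂ (G (T₁ x))

/-- The composition `H J ∘ ⋯ ∘ H 2 ∘ H 1` (the identity for `J = 0`). -/
def layerComp {X : Type*} (H : ℕ → X → X) : ℕ → X → X
  | 0 => id
  | J + 1 => H (J + 1) ∘ layerComp H J

/-- `F` equals, on the open ball of radius `r₁` about `0`, a composition
`H J ∘ ⋯ ∘ H 1 ∘ A₀`, where `A₀` is the identity or the reflection across the hyperplane orthogonal
to `e`, and every `H k = Id + B k` is a strongly monotone layer with `B k` compact and
`Lip (B k) < ε`. -/
def HasLayerFactorization {X : Type*} [NormedAddCommGroup X] [InnerProductSpace ℝ X]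
    (e : X) (F : X → X) (r₁ ε : ℝ) (J : ℕ) : Prop :=
  ∃ (A₀ : X ≃L[ℝ] X) (H B : ℕ → X → X),
    ((∀ x : X, A₀ x = x) ∨ (∀ x : X, A₀ x = x - (2 * inner ℝ x e) • e)) ∧
    (∀ k : ℕ, 1 ≤ k → k ≤ J →
      (∀ x : X, H k x = x + B k x) ∧
      StronglyMonotoneMap (H k) ∧
      BoundedNeuralOperatorLayer (H k) ∧
      CompactMap (B k) ∧
      ∃ K : NNReal, (K : ℝ) < ε ∧ LipschitzWith K (B k)) ∧
    ∀ x ∈ Metric.ball (0 : X) r₁, F x = layerComp H J (A₀ x)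

/-! The layer `F = Id + T₂ G T₁` is joined to its linear part at `0` by `Id + T₂ Γ_t T₁`, where `Γ_t
z = (G (t z) - G 0) / t`. This is `F`, up to a constant, conjugated by a dilation, so the lower
Lipschitz constant is the same for every `t`. A lower bound makes each derivative invertible
(Fredholm), hence each member of the path bijective with a `C¹` inverse (`exists_contDiff_zero`).

Two nearby members of such a path differ on a ball by one factor `Id + B`, with `B = T₂ E T₁` and
`E` a small cutoff map (`eventually_reachable`). That factor splits exactly into `N` factors of
Lipschitz constant `1 / N`, because `Id + s B` can be inverted and `B` rewritten in the new variable
(`ElementaryLayer.exists_comp_inverse`). Connectedness of the parameter line makes the number of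
factors `Id + B` finite and independent of `N` (`reachable_of_path`). So the count is `O(1 / ε)`,
which implies the claimed rate.

It remains to reach the linear part `Id + T₂ (DG 0) T₁`. A segment deforms it to a finite rank
perturbation of the identity, which factors into rank one updates. Those of positive determinant are
reached by a segment from the identity, those of negative determinant cancel in pairs, and at most
one reflection survives: this is `A₀`. -/

/-! ### Global inversion of layers -/

/-- The Fredholm alternative: an injective compact perturbation of the identity is invertible. -/
lemma exists_equiv_of_injective_id_add_compact {X : Type*} [NormedAddCommGroup X] [NormedSpace ℝ X]
    [CompleteSpace X] (K : X →L[ℝ] X) (hK : IsCompactOperator K)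
    (hinj : ∀ x, x + K x = 0 → x = 0) : ∃ e : X ≃L[ℝ] X, ∀ x, e x = x + K x := by
  have hneg : IsCompactOperator (-K : X →L[ℝ] X) := hK.neg
  rcases hneg.hasEigenvalue_or_mem_resolventSet (one_ne_zero (α := ℝ)) with h | h
  · obtain ⟨v, hv⟩ := h.exists_hasEigenvector
    refine absurd (hinj v ?_) hv.2
    have := hv.apply_eq_smul
    simp only [one_smul] at this
    change -K v = v at this
    nth_rw 1 [← this]; simp
  · have hu : IsUnit (algebraMap ℝ (X →L[ℝ] X) 1 - -K) := h
    obtain ⟨u, hu⟩ := hu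
    refine ⟨ContinuousLinearEquiv.unitsEquiv ℝ X u, fun x => ?_⟩
    rw [ContinuousLinearEquiv.unitsEquiv_apply, hu]
    simp

/-- Difference quotients along the line `x + t • h` inherit the bound and converge to `f' h`. This
makes derivatives injective, so the Fredholm alternative applies to them. -/
lemma HasFDerivAt.lower_bound {E F : Type*} [NormedAddCommGroup E] [NormedSpace ℝ E]
    [NormedAddCommGroup F] [NormedSpace ℝ F] {f : E → F} {f' : E →L[ℝ] F} {x : E}
    (hf : HasFDerivAt f f' x) {c : ℝ} (hc : ∀ v v', c * ‖v - v'‖ ≤ ‖f v - f v'‖) (h : E) :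
    c * ‖h‖ ≤ ‖f' h‖ := by
  have hl : HasDerivAt (fun t : ℝ => f (x + t • h)) (f' h) 0 := by
    have h1 : HasFDerivAt f f' (x + (0 : ℝ) • h) := by simpa using hf
    have h2 : HasDerivAt (fun t : ℝ => x + t • h) h 0 := by
      simpa using ((hasDerivAt_id (0 : ℝ)).smul_const h).const_add x
    exact h1.comp_hasDerivAt 0 h2
  have ht := (hasDerivAt_iff_tendsto_slope.1 hl).norm
  refine ge_of_tendsto ht ?_
  filter_upwards [self_mem_nhdsWithin] with t ht
  have ht0 : t ≠ 0 := ht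
  rw [slope_def_module]
  have h3 := hc (x + t • h) (x + (0 : ℝ) • h)
  simp only [zero_smul, add_zero, add_sub_cancel_left, norm_smul, Real.norm_eq_abs] at h3
  simp only [sub_zero, zero_smul, add_zero, norm_smul, norm_inv, Real.norm_eq_abs]
  rw [inv_mul_eq_div, le_div_iff₀ (abs_pos.2 ht0)]
  linarith

/-- A `C¹` map with a global lower Lipschitz bound and invertible derivatives is bijective. -/
lemma surjective_of_lower_bound {X : Type*} [NormedAddCommGroup X] [NormedSpace ℝ X]
    [CompleteSpace X] {f : X → X} {f' : X → X ≃L[ℝ] X} {c : ℝ} (hc : 0 < c)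
    (hf : ∀ x, HasStrictFDerivAt f (f' x : X →L[ℝ] X) x)
    (hlow : ∀ v v', c * ‖v - v'‖ ≤ ‖f v - f v'‖) : Function.Surjective f := by
  -- The range is open by the inverse function theorem and closed by the lower bound, hence
  -- everything.
  have hopen : IsOpen (Set.range f) := (isOpenMap_of_hasStrictFDerivAt_equiv hf).isOpen_range
  have hcont : Continuous f := continuous_iff_continuousAt.2 fun x => (hf x).continuousAt
  have hclosed : IsClosed (Set.range f) := by
    refine IsSeqClosed.isClosed ?_
    intro y p hy hp
    choose x hx using hy
    have hcs : CauchySeq x := by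
      rw [Metric.cauchySeq_iff]
      intro ε hε
      obtain ⟨N, hN⟩ := Metric.cauchySeq_iff.1 hp.cauchySeq (c * ε) (by positivity)
      refine ⟨N, fun m hm n hn => ?_⟩
      have h1 := hN m hm n hn
      rw [dist_eq_norm, ← hx, ← hx] at h1
      rw [dist_eq_norm]
      exact lt_of_mul_lt_mul_left ((hlow _ _).trans_lt h1) hc.le
    obtain ⟨a, ha⟩ := cauchySeq_tendsto_of_complete hcs
    refine ⟨a, tendsto_nhds_unique ((hcont.tendsto a).comp ha) ?_⟩
    simpa [Function.comp_def, hx] using hp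
  have := IsClopen.eq_univ ⟨hclosed, hopen⟩ (Set.range_nonempty f)
  exact Set.range_eq_univ.1 this

/-- The maps `v ↦ v + T₂ (G (w + T₁ v))` have a zero depending `C¹` on `w`, if they are uniformly
bounded below. -/
lemma exists_contDiff_zero {X : Type*} [NormedAddCommGroup X] [NormedSpace ℝ X]
    [CompleteSpace X] {T₁ T₂ : X →L[ℝ] X} (hT₁ : IsCompactOperator T₁)
    {G : X → X} (hG : ContDiff ℝ 1 G) {c : ℝ} (hc : 0 < c)
    (hlow : ∀ w v v', c * ‖v - v'‖ ≤ ‖(v + T₂ (G (w + T₁ v))) - (v' + T₂ (G (w + T₁ v')))‖) :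
    ∃ V : X → X, ContDiff ℝ 1 V ∧ ∀ w v, v + T₂ (G (w + T₁ v)) = 0 ↔ v = V w := by
  have hcomp : ∀ D : X →L[ℝ] X, IsCompactOperator (T₂ ∘L D ∘L T₁) := fun D =>
    (hT₁.clm_comp (T₂ ∘L D) :)
  have hG' : ∀ z, HasStrictFDerivAt G (fderiv ℝ G z) z := fun z =>
    hG.contDiffAt.hasStrictFDerivAt (by simp)
  have hder : ∀ w v, HasStrictFDerivAt (fun v => v + T₂ (G (w + T₁ v)))
      (ContinuousLinearMap.id ℝ X + T₂ ∘L fderiv ℝ G (w + T₁ v) ∘L T₁) v := by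
    intro w v
    refine (hasStrictFDerivAt_id v).add (T₂.hasStrictFDerivAt.comp v ?_)
    refine (hG' (w + T₁ v)).comp v ?_
    exact T₁.hasStrictFDerivAt.const_add w
  have hbd : ∀ w v h, c * ‖h‖ ≤ ‖h + T₂ (fderiv ℝ G (w + T₁ v) (T₁ h))‖ := fun w v h =>
    (hder w v).hasFDerivAt.lower_bound (hlow w) h
  have hequiv : ∀ w v, ∃ e : X ≃L[ℝ] X, ∀ h, e h = h + T₂ (fderiv ℝ G (w + T₁ v) (T₁ h)) := by
    intro w v
    refine exists_equiv_of_injective_id_add_compact _ (hcomp (fderiv ℝ G (w + T₁ v))) ?_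
    intro x hx
    have h1 := hbd w v x
    have h2 : x + T₂ (fderiv ℝ G (w + T₁ v) (T₁ x)) = 0 := hx
    rw [h2, norm_zero] at h1
    exact norm_le_zero_iff.1 (nonpos_of_mul_nonpos_right h1 hc)
  choose e he using hequiv
  have hsurj : ∀ w, Function.Surjective (fun v => v + T₂ (G (w + T₁ v))) := by
    intro w
    refine surjective_of_lower_bound (f' := e w) hc (fun v => ?_) (hlow w)
    convert hder w v using 1
    ext h; simp [he]
  have hinj : ∀ w, Function.Injective (fun v => v + T₂ (G (w + T₁ v))) := by
    intro w v v' h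
    have h1 := hlow w v v'
    have h2 : v + T₂ (G (w + T₁ v)) = v' + T₂ (G (w + T₁ v')) := h
    rw [h2, sub_self, norm_zero] at h1
    exact sub_eq_zero.1 (norm_le_zero_iff.1 (nonpos_of_mul_nonpos_right h1 hc))
  -- Carrying the parameter `w` along turns the parametric equation into a single global inversion.
  -- The derivative of `Ξ` is block triangular with invertible diagonal blocks.
  let Ξ : X × X → X × X := fun p => (p.1, p.2 + T₂ (G (p.1 + T₁ p.2)))
  have hΞ : ContDiff ℝ 1 Ξ := by
    refine contDiff_fst.prodMk (contDiff_snd.add (T₂.contDiff.comp (hG.comp ?_)))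
    exact contDiff_fst.add (T₁.contDiff.comp contDiff_snd)
  let Λ : X × X → (X × X →L[ℝ] X × X) := fun p =>
    (ContinuousLinearMap.fst ℝ X X).prod (ContinuousLinearMap.snd ℝ X X +
      T₂ ∘L fderiv ℝ G (p.1 + T₁ p.2) ∘L
        (ContinuousLinearMap.fst ℝ X X + T₁ ∘L ContinuousLinearMap.snd ℝ X X))
  have hΛ : ∀ p h, Λ p h = (h.1, e p.1 p.2 h.2 + T₂ (fderiv ℝ G (p.1 + T₁ p.2) h.1)) := by
    intro p h
    ext
    · simp [Λ]
    · simp [Λ, he]; abel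
  have hΞΛ : ∀ p, HasStrictFDerivAt Ξ (Λ p) p := by
    intro p
    refine hasStrictFDerivAt_fst.prodMk (hasStrictFDerivAt_snd.add (T₂.hasStrictFDerivAt.comp p ?_))
    refine (hG' (p.1 + T₁ p.2)).comp p ?_
    exact hasStrictFDerivAt_fst.add (T₁.hasStrictFDerivAt.comp p hasStrictFDerivAt_snd)
  have hΛe : ∀ p, ∃ E : (X × X) ≃L[ℝ] (X × X), (E : X × X →L[ℝ] X × X) = Λ p := by
    intro p
    refine ⟨ContinuousLinearEquiv.ofBijective (Λ p) ?_ ?_, by ext <;> rfl⟩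
    · refine LinearMap.ker_eq_bot'.2 fun h hh => ?_
      have h0 : Λ p h = 0 := hh
      rw [hΛ] at h0
      have h1 : h.1 = 0 := (Prod.ext_iff.1 h0).1
      have h2 := (Prod.ext_iff.1 h0).2
      simp only [h1, map_zero, add_zero, Prod.snd_zero] at h2
      exact Prod.ext h1 ((e p.1 p.2).map_eq_zero_iff.1 h2)
    · refine LinearMap.range_eq_top.2 fun q => ?_
      refine ⟨(q.1, (e p.1 p.2).symm (q.2 - T₂ (fderiv ℝ G (p.1 + T₁ p.2) q.1))), ?_⟩
      change Λ p _ = q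
      rw [hΛ]
      simp
  choose E hE using hΛe
  have hΞ' : ∀ p, HasStrictFDerivAt Ξ (E p : X × X →L[ℝ] X × X) p := fun p => by
    rw [hE]; exact hΞΛ p
  have hbij : Function.Bijective Ξ := by
    constructor
    · intro p q h
      have h1 : p.1 = q.1 := (Prod.ext_iff.1 h).1
      have h2 : p.2 + T₂ (G (p.1 + T₁ p.2)) = q.2 + T₂ (G (q.1 + T₁ q.2)) := (Prod.ext_iff.1 h).2
      rw [← h1] at h2
      exact Prod.ext h1 (hinj p.1 h2)
    · intro q
      obtain ⟨v, hv⟩ := hsurj q.1 q.2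
      exact ⟨(q.1, v), Prod.ext rfl hv⟩
  let Φ : X × X ≃ₜ X × X := (Equiv.ofBijective Ξ hbij).toHomeomorphOfContinuousOpen hΞ.continuous
    (isOpenMap_of_hasStrictFDerivAt_equiv hΞ')
  have hΦ : ∀ p, Φ p = Ξ p := fun p => rfl
  have hsymm : ContDiff ℝ 1 (Φ.symm : X × X → X × X) :=
    Φ.contDiff_symm (f₀' := E) (fun p => (hΞ' p).hasFDerivAt) hΞ
  refine ⟨fun w => (Φ.symm (w, 0)).2, ?_, fun w v => ?_⟩
  · exact contDiff_snd.comp (hsymm.comp (contDiff_id.prodMk contDiff_const))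
  · have h1 : Ξ (Φ.symm (w, 0)) = (w, 0) := by rw [← hΦ, Φ.apply_symm_apply]
    have h2 : (Φ.symm (w, 0)).1 = w := (Prod.ext_iff.1 h1).1
    have h3 := (Prod.ext_iff.1 h1).2
    simp only [Ξ, h2] at h3
    constructor
    · intro h
      exact hinj w (h.trans h3.symm)
    · rintro rfl
      exact h3

/-! ### Elementary layers and reachability -/

/-- A map `T₂ ∘ G ∘ T₁` with `T₁`, `T₂` compact, `G` of class `C¹`, bounded and Lipschitz, such that
`T₂ ∘ G` is `δ`-Lipschitz in the directions of the range of `T₁`. -/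
def ElementaryLayer {X : Type*} [NormedAddCommGroup X] [InnerProductSpace ℝ X] (δ : ℝ)
    (B : X → X) : Prop :=
  ∃ (T₁ T₂ : X →L[ℝ] X) (G : X → X),
    IsCompactOperator T₁ ∧ IsCompactOperator T₂ ∧ ContDiff ℝ 1 G ∧
      (∃ M : NNReal, (∀ x, ‖G x‖ ≤ M) ∧ LipschitzWith M G) ∧
      (∀ w u, ‖T₂ (G (w + T₁ u)) - T₂ (G w)‖ ≤ δ * ‖u‖) ∧
      ∀ x, B x = T₂ (G (T₁ x))

/-- `Φ` is a composition of `n` maps `Id + B` with `B` an elementary layer of constant `δ`. -/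
inductive LayerProduct {X : Type*} [NormedAddCommGroup X] [InnerProductSpace ℝ X] (δ : ℝ) :
    ℕ → (X → X) → Prop
  | nil : LayerProduct δ 0 id
  | cons {n : ℕ} {Φ B : X → X} : ElementaryLayer δ B → LayerProduct δ n Φ →
      LayerProduct δ (n + 1) (fun x => Φ x + B (Φ x))

/-- On the set `S`, the map `g` is obtained from `f` by composing with products of elementary
layers, `O(N)` layers of constant `1 / N` being enough. -/
def Reachable {X : Type*} [NormedAddCommGroup X] [InnerProductSpace ℝ X] (S : Set X)
    (f g : X → X) : Prop :=
  ∃ C : ℕ, ∀ N : ℕ, 0 < N → ∃ Φ : X → X, LayerProduct (1 / (N : ℝ)) (C * N) Φ ∧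
    ∀ x ∈ S, g x = Φ (f x)

section
variable {X : Type*} [NormedAddCommGroup X] [InnerProductSpace ℝ X]

lemma LayerProduct.comp {δ : ℝ} {m n : ℕ} {Φ Ψ : X → X} (hΨ : LayerProduct δ n Ψ)
    (hΦ : LayerProduct δ m Φ) : LayerProduct δ (m + n) (Ψ ∘ Φ) := by
  induction hΨ with
  | nil => exact hΦ
  | cons hB _ ih => exact .cons hB ih

lemma Reachable.refl (S : Set X) (f : X → X) : Reachable S f f :=
  ⟨0, fun N _ => ⟨id, by simpa using LayerProduct.nil, fun _ _ => rfl⟩⟩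

lemma Reachable.trans {S : Set X} {f g h : X → X} (h₁ : Reachable S f g) (h₂ : Reachable S g h) :
    Reachable S f h := by
  obtain ⟨C, hC⟩ := h₁
  obtain ⟨D, hD⟩ := h₂
  refine ⟨C + D, fun N hN => ?_⟩
  obtain ⟨Φ, hΦ, hΦ'⟩ := hC N hN
  obtain ⟨Ψ, hΨ, hΨ'⟩ := hD N hN
  refine ⟨Ψ ∘ Φ, ?_, fun x hx => ?_⟩
  · rw [add_mul]
    exact hΨ.comp hΦ
  · rw [hΨ' x hx, hΦ' x hx]; rfl

lemma Reachable.precomp {S S' : Set X} {f g h : X → X} (hr : Reachable S f g)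
    (hh : ∀ x ∈ S', h x ∈ S) : Reachable S' (fun x => f (h x)) (fun x => g (h x)) := by
  obtain ⟨C, hC⟩ := hr
  refine ⟨C, fun N hN => ?_⟩
  obtain ⟨Φ, hΦ, hΦ'⟩ := hC N hN
  exact ⟨Φ, hΦ, fun x hx => hΦ' _ (hh x hx)⟩

lemma Reachable.congr {S : Set X} {f g f' g' : X → X} (hr : Reachable S f g)
    (hf : ∀ x ∈ S, f' x = f x) (hg : ∀ x ∈ S, g' x = g x) : Reachable S f' g' := by
  obtain ⟨C, hC⟩ := hr
  refine ⟨C, fun N hN => ?_⟩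
  obtain ⟨Φ, hΦ, hΦ'⟩ := hC N hN
  exact ⟨Φ, hΦ, fun x hx => by rw [hf x hx, hg x hx, hΦ' x hx]⟩

lemma ElementaryLayer.smul {δ : ℝ} {B : X → X} (hB : ElementaryLayer δ B) (a : ℝ) :
    ElementaryLayer (|a| * δ) (fun x => a • B x) := by
  obtain ⟨T₁, T₂, G, hT₁, hT₂, hG, ⟨M, hM, hL⟩, hδ, hB⟩ := hB
  refine ⟨T₁, T₂, fun x => a • G x, hT₁, hT₂, contDiff_const.smul hG, ⟨‖a‖₊ * M, fun x => ?_, ?_⟩,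
    fun w u => ?_, fun x => ?_⟩
  · rw [norm_smul, NNReal.coe_mul, coe_nnnorm]
    exact mul_le_mul_of_nonneg_left (hM x) (norm_nonneg a)
  · exact (lipschitzWith_smul a).comp hL
  · rw [map_smul, map_smul, ← smul_sub, norm_smul, Real.norm_eq_abs, mul_assoc]
    exact mul_le_mul_of_nonneg_left (hδ w u) (abs_nonneg a)
  · simp only [hB, map_smul]

/-- Reparametrisation of an elementary layer `B` by the inverse of `Id + s B`. -/
lemma ElementaryLayer.exists_comp_inverse [CompleteSpace X] {B : X → X}
    (hB : ElementaryLayer (1 / 2) B) {s : ℝ} (hs0 : 0 ≤ s) (hs1 : s ≤ 1) :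
    ∃ B' : X → X, ElementaryLayer 1 B' ∧ ∀ x, B' (x + s • B x) = B x := by
  obtain ⟨T₁, T₂, G, hT₁, hT₂, hG, ⟨M, hM, hL⟩, hδ, hB⟩ := hB
  -- The bound of an elementary layer holds around every `w`, not only on the range of `T₁`; this is
  -- what lets `V` be defined on all of `X`.
  have key : ∀ w v v', ‖T₂ (G (w + T₁ v)) - T₂ (G (w + T₁ v'))‖ ≤ 1 / 2 * ‖v - v'‖ := by
    intro w v v'
    have := hδ (w + T₁ v') (v - v')
    rwa [map_sub, add_assoc, add_sub_cancel] at this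
  have hlow : ∀ w v v', (1 / 2 : ℝ) * ‖v - v'‖ ≤
      ‖(v + T₂ (s • G (w + T₁ v))) - (v' + T₂ (s • G (w + T₁ v')))‖ := by
    intro w v v'
    have h1 : (v + T₂ (s • G (w + T₁ v))) - (v' + T₂ (s • G (w + T₁ v'))) =
        (v - v') + s • (T₂ (G (w + T₁ v)) - T₂ (G (w + T₁ v'))) := by
      rw [map_smul, map_smul, smul_sub]; abel
    have h2 : ‖s • (T₂ (G (w + T₁ v)) - T₂ (G (w + T₁ v')))‖ ≤ 1 / 2 * ‖v - v'‖ := by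
      rw [norm_smul, Real.norm_eq_abs, abs_of_nonneg hs0]
      nlinarith [key w v v', norm_nonneg (v - v'),
        norm_nonneg (T₂ (G (w + T₁ v)) - T₂ (G (w + T₁ v')))]
    have h3 := norm_sub_le_norm_add (v - v') (s • (T₂ (G (w + T₁ v)) - T₂ (G (w + T₁ v'))))
    rw [h1]
    linarith
  -- The inverse of `Id + s B` is `y ↦ y + V (T₁ y)`: for `y = x + s B x` the zero is `-s B x = x -
  -- y`.
  obtain ⟨V, hV, hVz⟩ := exists_contDiff_zero (T₂ := T₂) hT₁ (G := fun x => s • G x)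
    (contDiff_const.smul hG) (c := 1 / 2) (by norm_num) hlow
  have hVeq : ∀ w, V w = -(s • T₂ (G (w + T₁ (V w)))) := by
    intro w
    have := (hVz w (V w)).2 rfl
    rw [map_smul] at this
    exact eq_neg_of_add_eq_zero_left this
  have hVL : LipschitzWith (2 * (‖T₂‖₊ * M)) V := by
    refine LipschitzWith.of_dist_le_mul fun w w' => ?_
    rw [dist_eq_norm, dist_eq_norm]
    have h1 := hlow w (V w) (V w')
    rw [(hVz w (V w)).2 rfl] at h1
    have h2 : V w' = -(T₂ (s • G (w' + T₁ (V w')))) :=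
      eq_neg_of_add_eq_zero_left ((hVz w' (V w')).2 rfl)
    have h3 : ‖(0 : X) - (V w' + T₂ (s • G (w + T₁ (V w'))))‖ ≤ ‖T₂‖ * (M * ‖w - w'‖) := by
      rw [show (0 : X) - (V w' + T₂ (s • G (w + T₁ (V w')))) =
          T₂ (s • (G (w' + T₁ (V w')) - G (w + T₁ (V w')))) by
        nth_rw 1 [h2]; simp only [map_smul, map_sub, smul_sub]; abel]
      refine (T₂.le_opNorm _).trans (mul_le_mul_of_nonneg_left ?_ (norm_nonneg _))
      rw [norm_smul, Real.norm_eq_abs, abs_of_nonneg hs0]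
      have h4 := hL.dist_le_mul (w' + T₁ (V w')) (w + T₁ (V w'))
      rw [dist_eq_norm, dist_eq_norm, add_sub_add_right_eq_sub, norm_sub_rev w' w] at h4
      nlinarith [norm_nonneg (G (w' + T₁ (V w')) - G (w + T₁ (V w')))]
    simp only [NNReal.coe_mul, NNReal.coe_ofNat, coe_nnnorm]
    linarith
  have hΨL : LipschitzWith (1 + ‖T₁‖₊ * (2 * (‖T₂‖₊ * M))) (fun w => w + T₁ (V w)) :=
    LipschitzWith.id.add (T₁.lipschitz.comp hVL)
  refine ⟨fun y => T₂ (G (T₁ y + T₁ (V (T₁ y)))), ⟨T₁, T₂, fun w => G (w + T₁ (V w)), hT₁, hT₂,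
    hG.comp (contDiff_id.add (T₁.contDiff.comp hV)),
    ⟨M * (1 + (1 + ‖T₁‖₊ * (2 * (‖T₂‖₊ * M)))), fun x => ?_, ?_⟩, fun w u => ?_,
    fun x => rfl⟩, fun x => ?_⟩
  · refine (hM _).trans ?_
    exact_mod_cast le_mul_of_one_le_right (zero_le (a := M)) le_self_add
  · exact (hL.comp hΨL).weaken (mul_le_mul_right (le_add_of_nonneg_left zero_le_one) M)
  -- Let `d` be the norm of the increment of the new map. Since `V` moves by at most `s d ≤ d`, the
  -- bound `1 / 2` gives `d ≤ (‖u‖ + d) / 2`, that is, `d ≤ ‖u‖`.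
  · have h1 := hδ (w + T₁ (V w)) (u + (V (w + T₁ u) - V w))
    have e1 : w + T₁ (V w) + T₁ (u + (V (w + T₁ u) - V w)) =
        w + T₁ u + T₁ (V (w + T₁ u)) := by
      simp only [map_add, map_sub]; abel
    rw [e1] at h1
    have h2 : V (w + T₁ u) - V w =
        -(s • (T₂ (G (w + T₁ u + T₁ (V (w + T₁ u)))) - T₂ (G (w + T₁ (V w))))) := by
      conv_lhs => rw [hVeq (w + T₁ u), hVeq w]
      rw [smul_sub]; abel
    have h3 : ‖V (w + T₁ u) - V w‖ ≤
        ‖T₂ (G (w + T₁ u + T₁ (V (w + T₁ u)))) - T₂ (G (w + T₁ (V w)))‖ := by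
      rw [h2, norm_neg, norm_smul, Real.norm_eq_abs, abs_of_nonneg hs0]
      exact mul_le_of_le_one_left (norm_nonneg _) hs1
    have h4 := norm_add_le u (V (w + T₁ u) - V w)
    linarith
  · have h1 : -(s • B x) = V (T₁ (x + s • B x)) := by
      refine (hVz _ _).1 ?_
      have : T₁ (x + s • B x) + T₁ (-(s • B x)) = T₁ x := by
        rw [← map_add]; congr 1; abel
      rw [this, map_smul, ← hB]; abel
    change T₂ (G (T₁ (x + s • B x) + T₁ (V (T₁ (x + s • B x))))) = B x
    rw [← h1, ← map_add, add_neg_cancel_right, ← hB]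

/-- Telescoping along `s = n / N`: the increment `B x / N` is an elementary function of the current
point `x + s B x`, so each step is exact and costs one layer. -/
lemma ElementaryLayer.reachable [CompleteSpace X] {B : X → X} (hB : ElementaryLayer (1 / 2) B)
    (S : Set X) : Reachable S id (fun x => x + B x) := by
  refine ⟨1, fun N hN => ?_⟩
  have hN' : (0 : ℝ) < N := by exact_mod_cast hN
  suffices h : ∀ n : ℕ, n ≤ N → ∃ Φ : X → X, LayerProduct (1 / (N : ℝ)) n Φ ∧
      ∀ x, x + ((n : ℝ) / N) • B x = Φ x by
    obtain ⟨Φ, hΦ, hΦ'⟩ := h N le_rfl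
    refine ⟨Φ, by simpa using hΦ, fun x _ => ?_⟩
    rw [id, ← hΦ', div_self hN'.ne', one_smul]
  intro n
  induction n with
  | zero => exact fun _ => ⟨id, .nil, fun x => by simp⟩
  | succ n ih =>
    intro hn
    obtain ⟨Φ, hΦ, hΦ'⟩ := ih (by omega)
    have hn' : (n : ℝ) ≤ N := by exact_mod_cast (by omega : n ≤ N)
    obtain ⟨B', hB', hBB'⟩ := hB.exists_comp_inverse (s := (n : ℝ) / N) (by positivity)
      ((div_le_one hN').2 hn')
    have h1 := hB'.smul (1 / (N : ℝ))
    rw [abs_of_pos (by positivity), mul_one] at h1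
    refine ⟨_, .cons h1 hΦ, fun x => ?_⟩
    rw [← hΦ', hBB']
    push_cast
    rw [add_assoc, ← add_smul, add_div]

/-- The same telescoping run backwards, with `s = 1 - n / N` and increments `-B x / N`. -/
lemma ElementaryLayer.reachable_symm [CompleteSpace X] {B : X → X}
    (hB : ElementaryLayer (1 / 2) B) (S : Set X) : Reachable S (fun x => x + B x) id := by
  refine ⟨1, fun N hN => ?_⟩
  have hN' : (0 : ℝ) < N := by exact_mod_cast hN
  suffices h : ∀ n : ℕ, n ≤ N → ∃ Φ : X → X, LayerProduct (1 / (N : ℝ)) n Φ ∧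
      ∀ x, x + (1 - (n : ℝ) / N) • B x = Φ (x + B x) by
    obtain ⟨Φ, hΦ, hΦ'⟩ := h N le_rfl
    refine ⟨Φ, by simpa using hΦ, fun x _ => ?_⟩
    rw [← hΦ', div_self hN'.ne', sub_self, zero_smul, add_zero, id]
  intro n
  induction n with
  | zero => exact fun _ => ⟨id, .nil, fun x => by simp⟩
  | succ n ih =>
    intro hn
    obtain ⟨Φ, hΦ, hΦ'⟩ := ih (by omega)
    have hn' : (n : ℝ) ≤ N := by exact_mod_cast (by omega : n ≤ N)
    obtain ⟨B', hB', hBB'⟩ := hB.exists_comp_inverse (s := 1 - (n : ℝ) / N)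
      (sub_nonneg.2 ((div_le_one hN').2 hn')) (sub_le_self _ (by positivity))
    have h1 := hB'.smul (-(1 / (N : ℝ)))
    rw [abs_neg, abs_of_pos (by positivity), mul_one] at h1
    refine ⟨_, .cons h1 hΦ, fun x => ?_⟩
    rw [← hΦ', hBB']
    push_cast
    rw [add_assoc, ← add_smul, add_div]
    congr 2
    ring

lemma ElementaryLayer.boundedNeuralOperatorLayer {δ : ℝ} {B : X → X} (hB : ElementaryLayer δ B) :
    BoundedNeuralOperatorLayer (fun x => x + B x) := by
  obtain ⟨T₁, T₂, G, hT₁, hT₂, hG, ⟨M, hM, hL⟩, hδ, hB⟩ := hB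
  exact ⟨T₁, T₂, G, hT₁, hT₂, hG, ⟨M, fun x => ⟨hM x, norm_fderiv_le_of_lipschitz ℝ hL⟩⟩,
    fun x => by simp only [hB]⟩

lemma compactMap_comp_compactOperator {T₁ T₂ : X →L[ℝ] X} (hT₁ : IsCompactOperator T₁) {G : X → X}
    (hG : Continuous G) : CompactMap (fun x => T₂ (G (T₁ x))) := by
  refine ⟨T₂.continuous.comp (hG.comp T₁.continuous), fun s hs => ?_⟩
  obtain ⟨K, hK, hsK⟩ :=
    IsCompactOperator.image_subset_compact_of_bounded (f := (T₁ : X →ₗ[ℝ] X)) hT₁ hs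
  refine (hK.image (T₂.continuous.comp hG)).closure_of_subset ?_
  rintro _ ⟨x, hx, rfl⟩
  exact ⟨T₁ x, hsK ⟨x, hx, rfl⟩, rfl⟩

lemma ElementaryLayer.compactMap {δ : ℝ} {B : X → X} (hB : ElementaryLayer δ B) :
    CompactMap B := by
  obtain ⟨T₁, T₂, G, hT₁, hT₂, hG, -, -, hB⟩ := hB
  rw [show B = fun x => T₂ (G (T₁ x)) from funext hB]
  exact compactMap_comp_compactOperator hT₁ hG.continuous

lemma ElementaryLayer.norm_sub_le {δ : ℝ} {B : X → X} (hB : ElementaryLayer δ B) (x y : X) :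
    ‖B x - B y‖ ≤ δ * ‖x - y‖ := by
  obtain ⟨T₁, T₂, G, hT₁, hT₂, hG, -, hδ, hB⟩ := hB
  have := hδ (T₁ y) (x - y)
  rwa [map_sub, add_sub_cancel, ← hB, ← hB] at this

/-- Cauchy–Schwarz: the perturbation costs at most `δ` of the identity's monotonicity constant `1`.
-/
lemma ElementaryLayer.stronglyMonotoneMap {δ : ℝ} {B : X → X} (hB : ElementaryLayer δ B)
    (hδ : δ < 1) : StronglyMonotoneMap (fun x => x + B x) := by
  refine ⟨1 - δ, by linarith, fun x y => ?_⟩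
  have h1 : x + B x - (y + B y) = (x - y) + (B x - B y) := by abel
  rw [h1, inner_add_left, real_inner_self_eq_norm_sq]
  have h2 := abs_real_inner_le_norm (B x - B y) (x - y)
  have h3 := neg_abs_le (inner ℝ (B x - B y) (x - y))
  have h4 := mul_le_mul_of_nonneg_right (hB.norm_sub_le x y) (norm_nonneg (x - y))
  nlinarith

lemma LayerProduct.exists_layerComp {δ ε : ℝ} (hδ : 0 ≤ δ) (hδ1 : δ < 1) (hδε : δ < ε) {n : ℕ}
    {Φ : X → X} (h : LayerProduct δ n Φ) :
    ∃ H B : ℕ → X → X, (∀ k : ℕ, 1 ≤ k → k ≤ n →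
      (∀ x : X, H k x = x + B k x) ∧ StronglyMonotoneMap (H k) ∧
      BoundedNeuralOperatorLayer (H k) ∧ CompactMap (B k) ∧
      ∃ K : NNReal, (K : ℝ) < ε ∧ LipschitzWith K (B k)) ∧ Φ = layerComp H n := by
  induction h with
  | nil => exact ⟨fun _ => id, fun _ => id, fun k h1 h2 => by omega, rfl⟩
  | @cons n Φ B hB _ ih =>
    obtain ⟨H, Bs, hH, hΦ⟩ := ih
    -- Filling slot `n + 1` leaves the shorter compositions unchanged.
    have hcongr : ∀ m ≤ n, layerComp (Function.update H (n + 1) (fun x => x + B x)) m =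
        layerComp H m := by
      intro m
      induction m with
      | zero => exact fun _ => rfl
      | succ m ihm =>
        intro hm
        simp only [layerComp]
        rw [ihm (by omega), Function.update_of_ne (by omega)]
    refine ⟨Function.update H (n + 1) (fun x => x + B x), Function.update Bs (n + 1) B,
      fun k h1 h2 => ?_, ?_⟩
    · rcases eq_or_ne k (n + 1) with rfl | hk
      · simp only [Function.update_self]
        refine ⟨fun x => trivial, hB.stronglyMonotoneMap hδ1, hB.boundedNeuralOperatorLayer,
          hB.compactMap, ⟨δ, hδ⟩, hδε, LipschitzWith.of_dist_le_mul fun x y => ?_⟩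
        rw [dist_eq_norm, dist_eq_norm]
        exact hB.norm_sub_le x y
      · rw [Function.update_of_ne hk, Function.update_of_ne hk]
        exact hH k h1 (by omega)
    · simp only [layerComp]
      rw [hcongr n le_rfl, Function.update_self, ← hΦ]
      rfl

end

/-! ### Smooth cutoffs around compact convex sets -/

section
variable {X : Type*} [NormedAddCommGroup X] [InnerProductSpace ℝ X]

lemma hasFDerivAt_of_norm_sub_le_sq {E F : Type*} [NormedAddCommGroup E] [NormedSpace ℝ E]
    [NormedAddCommGroup F] [NormedSpace ℝ F] {f : E → F} {f' : E →L[ℝ] F} {x : E} {C : ℝ}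
    (h : ∀ v, ‖f (x + v) - f x - f' v‖ ≤ C * ‖v‖ ^ 2) : HasFDerivAt f f' x := by
  rw [hasFDerivAt_iff_isLittleO_nhds_zero]
  have h1 : (fun v : E => f (x + v) - f x - f' v) =O[𝓝 0] fun v => ‖v‖ ^ 2 :=
    IsBigO.of_bound C (Eventually.of_forall fun v => by simpa using h v)
  exact h1.trans_isLittleO (isLittleO_norm_pow_id one_lt_two)

lemma hasDerivAt_max_zero_sq (u : ℝ) :
    HasDerivAt (fun s : ℝ => max 0 s ^ 2) (2 * max 0 u) u := by
  rw [hasDerivAt_iff_hasFDerivAt]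
  refine hasFDerivAt_of_norm_sub_le_sq (C := 1) fun v => ?_
  simp only [ContinuousLinearMap.toSpanSingleton_apply, smul_eq_mul, Real.norm_eq_abs, one_mul,
    sq_abs]
  rw [abs_le]
  rcases le_total 0 u with hu | hu <;> rcases le_total 0 (u + v) with hv | hv <;>
    simp only [max_eq_left, max_eq_right, hu, hv] <;> constructor <;> nlinarith

/-- The metric projection onto a complete convex set. -/
lemma exists_metric_projection {K : Set X} (hne : K.Nonempty) (hK : IsComplete K)
    (hconv : Convex ℝ K) :
    ∃ P : X → X, (∀ z, P z ∈ K) ∧ (∀ z, ∀ y ∈ K, ‖z - P z‖ ≤ ‖z - y‖) ∧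
      ∀ z w, ‖P z - P w‖ ^ 2 ≤ inner ℝ (P z - P w) (z - w) := by
  have h := exists_norm_eq_iInf_of_complete_convex hne hK hconv
  choose P hP hPinf using h
  have hin : ∀ z, ∀ y ∈ K, inner ℝ (z - P z) (y - P z) ≤ 0 := fun z =>
    (norm_eq_iInf_iff_real_inner_le_zero hconv (hP z)).1 (hPinf z)
  refine ⟨P, hP, fun z y hy => ?_, fun z w => ?_⟩
  · rw [hPinf z]
    exact ciInf_le ⟨0, by rintro _ ⟨y, rfl⟩; exact norm_nonneg _⟩ (⟨y, hy⟩ : K)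
  · have h1 := hin z (P w) (hP w)
    have h2 := hin w (P z) (hP z)
    have h3 : inner ℝ (z - P z) (P w - P z) + inner ℝ (w - P w) (P z - P w) =
        ‖P z - P w‖ ^ 2 - inner ℝ (P z - P w) (z - w) := by
      rw [← real_inner_self_eq_norm_sq, real_inner_comm (z - w), ← neg_sub (P z) (P w),
        inner_neg_right, ← sub_eq_neg_add, ← inner_sub_left, ← inner_sub_left]
      congr 1
      abel
    linarith

/-- Using the projection of each of `z`, `z + v` as a competitor for the other bounds the remainder
on both sides by `‖v‖ ^ 2`. No differentiability of `P` is needed. -/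
lemma hasFDerivAt_norm_sub_projection_sq {K : Set X} {P : X → X} (hP : ∀ z, P z ∈ K)
    (hmin : ∀ z, ∀ y ∈ K, ‖z - P z‖ ≤ ‖z - y‖)
    (hmono : ∀ z w, ‖P z - P w‖ ^ 2 ≤ inner ℝ (P z - P w) (z - w)) (z : X) :
    HasFDerivAt (fun z => ‖z - P z‖ ^ 2) ((2 : ℝ) • innerSL ℝ (z - P z)) z := by
  refine hasFDerivAt_of_norm_sub_le_sq (C := 1) fun v => ?_
  simp only [smul_apply, innerSL_apply_apply, smul_eq_mul,
    Real.norm_eq_abs, one_mul]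
  have h1 := pow_le_pow_left₀ (norm_nonneg _) (hmin (z + v) (P z) (hP z)) 2
  have h2 := pow_le_pow_left₀ (norm_nonneg _) (hmin z (P (z + v)) (hP _)) 2
  have e1 : z + v - P z = (z - P z) + v := by abel
  have e2 : z - P (z + v) = (z + v - P (z + v)) - v := by abel
  rw [e1, norm_add_sq_real] at h1
  rw [e2, norm_sub_sq_real (z + v - P (z + v)) v] at h2
  have h3 := hmono (z + v) z
  rw [add_sub_cancel_left] at h3
  have e3 : inner ℝ (z + v - P (z + v)) v =
      inner ℝ (z - P z) v + ‖v‖ ^ 2 - inner ℝ (P (z + v) - P z) v := by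
    rw [← real_inner_self_eq_norm_sq, ← inner_add_left, ← inner_sub_left]
    congr 1
    abel
  have h4 := real_inner_le_norm (P (z + v) - P z) v
  have h5 : ‖P (z + v) - P z‖ ≤ ‖v‖ := by
    by_contra hcon
    push Not at hcon
    nlinarith [norm_nonneg v]
  have h6 : ‖P (z + v) - P z‖ * ‖v‖ ≤ ‖v‖ ^ 2 := by
    nlinarith [norm_nonneg v]
  rw [abs_le]
  constructor <;> linarith

/-- A `C¹` cutoff function of a compact convex subset of a Hilbert space, whose gradient is
controlled by the width of the transition layer. -/
lemma exists_contDiff_cutoff {K : Set X} (hne : K.Nonempty) (hK : IsCompact K)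
    (hconv : Convex ℝ K) {η : ℝ} (hη : 0 < η) :
    ∃ χ : X → ℝ, ContDiff ℝ 1 χ ∧ (∀ z, |χ z| ≤ 1) ∧ (∀ z ∈ K, χ z = 1) ∧
      (∀ z, z ∉ Metric.thickening η K → χ z = 0 ∧ fderiv ℝ χ z = 0) ∧
      ∀ z, ‖fderiv ℝ χ z‖ ≤ 4 / η := by
  obtain ⟨P, hP, hmin, hmono⟩ := exists_metric_projection hne hK.isComplete hconv
  have hPL : LipschitzWith 1 P := by
    refine LipschitzWith.of_dist_le_mul fun z w => ?_
    rw [dist_eq_norm, dist_eq_norm, NNReal.coe_one, one_mul]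
    have h1 := hmono z w
    have h2 := real_inner_le_norm (P z - P w) (z - w)
    by_contra hcon
    push Not at hcon
    nlinarith [norm_nonneg (z - w)]
  -- The cutoff is `m ^ 2`: squaring the positive part makes it `C¹`. Its gradient has norm `4 m ‖z
  -- - P z‖ / η ^ 2`, and `m` vanishes beyond distance `η`, whence `4 / η`.
  let m : X → ℝ := fun z => max 0 (1 - ‖z - P z‖ ^ 2 / η ^ 2)
  have hm : Continuous m := by
    have := hPL.continuous
    fun_prop
  have hm0 : ∀ z, 0 ≤ m z := fun z => le_max_left _ _
  have hm1 : ∀ z, m z ≤ 1 := fun z => max_le zero_le_one (sub_le_self _ (by positivity))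
  let D : X → (X →L[ℝ] ℝ) := fun z => (-(4 * m z / η ^ 2)) • innerSL ℝ (z - P z)
  have hD : Continuous D := by
    have := hPL.continuous
    fun_prop
  have hder : ∀ z, HasFDerivAt (fun z => m z ^ 2) (D z) z := by
    intro z
    have h1 := ((hasFDerivAt_norm_sub_projection_sq hP hmin hmono z).const_mul
      ((η ^ 2)⁻¹)).const_sub 1
    have h2 := (hasDerivAt_max_zero_sq (1 - (η ^ 2)⁻¹ * ‖z - P z‖ ^ 2)).comp_hasFDerivAt z h1
    have e1 : (fun z => m z ^ 2) =
        (fun s : ℝ => max 0 s ^ 2) ∘ fun x => 1 - (η ^ 2)⁻¹ * ‖x - P x‖ ^ 2 := by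
      funext z
      simp only [m, div_eq_inv_mul, Function.comp_apply]
    have e2 : D z = (2 * max 0 (1 - (η ^ 2)⁻¹ * ‖z - P z‖ ^ 2)) •
        -((η ^ 2)⁻¹ • (2 : ℝ) • innerSL ℝ (z - P z)) := by
      simp only [D, m, div_eq_inv_mul, smul_smul, ← neg_smul]
      congr 1
      ring
    rw [e1, e2]
    exact h2
  have hout : ∀ z, z ∉ Metric.thickening η K → m z = 0 := by
    intro z hz
    have h1 : η ≤ ‖z - P z‖ := by
      by_contra hcon
      push Not at hcon
      exact hz (Metric.mem_thickening_iff.2 ⟨P z, hP z, by rwa [dist_eq_norm]⟩)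
    refine max_eq_left ?_
    rw [sub_nonpos, one_le_div (by positivity)]
    exact pow_le_pow_left₀ hη.le h1 2
  refine ⟨fun z => m z ^ 2, contDiff_one_iff_hasFDerivAt.2 ⟨D, hD, hder⟩, fun z => ?_,
    fun z hz => ?_, fun z hz => ⟨?_, ?_⟩, fun z => ?_⟩
  · rw [abs_of_nonneg (sq_nonneg _)]
    exact pow_le_one₀ (hm0 z) (hm1 z)
  · have h1 : ‖z - P z‖ = 0 := le_antisymm (by simpa using hmin z z hz) (norm_nonneg _)
    simp [m, h1]
  · simp [hout z hz]
  · rw [(hder z).fderiv]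
    simp [D, hout z hz]
  · rw [(hder z).fderiv]
    by_cases hz : z ∈ Metric.thickening η K
    · obtain ⟨y, hy, hzy⟩ := Metric.mem_thickening_iff.1 hz
      rw [dist_eq_norm] at hzy
      have h1 : ‖z - P z‖ ≤ η := (hmin z y hy).trans hzy.le
      have h2 : 0 ≤ 4 * m z / η ^ 2 := by have := hm0 z; positivity
      simp only [D]
      rw [norm_smul, norm_neg, Real.norm_eq_abs, abs_of_nonneg h2, innerSL_apply_norm]
      calc 4 * m z / η ^ 2 * ‖z - P z‖ ≤ 4 * 1 / η ^ 2 * η := by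
            gcongr
            exact hm1 z
        _ = 4 / η := by field_simp
    · have : D z = 0 := by simp [D, hout z hz]
      rw [this, norm_zero]
      positivity

/-- Cutting off a map outside of a neighbourhood of a compact convex set. -/
lemma exists_lipschitz_eqOn_compact {F : Type*} [NormedAddCommGroup F] [NormedSpace ℝ F] {K : Set X}
    (hne : K.Nonempty) (hK : IsCompact K)
    (hconv : Convex ℝ K) {η : ℝ} (hη : 0 < η) {D : X → F} (hD : ContDiff ℝ 1 D) {ε : NNReal}
    (hDK : ∀ w ∈ K, ‖D w‖ ≤ ε * η) (hD' : ∀ w ∈ Metric.thickening η K, ‖fderiv ℝ D w‖ ≤ ε) :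
    ∃ E : X → F, ContDiff ℝ 1 E ∧ (∀ w ∈ K, E w = D w) ∧ (∀ w, ‖E w‖ ≤ 2 * ε * η) ∧
      LipschitzWith (9 * ε) E := by
  obtain ⟨χ, hχ, hχ1, hχK, hχout, hχ'⟩ := exists_contDiff_cutoff hne hK hconv hη
  have hbd : ∀ w ∈ Metric.thickening η K, ‖D w‖ ≤ 2 * ε * η := by
    intro w hw
    obtain ⟨y, hy, hwy⟩ := Metric.mem_thickening_iff.1 hw
    have h1 := (convex_ball y η).norm_image_sub_le_of_norm_fderiv_le (𝕜 := ℝ) (f := D) (C := ε)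
      (fun x _ => (hD.differentiable (by simp)).differentiableAt)
      (fun x hx => hD' x (Metric.mem_thickening_iff.2 ⟨y, hy, hx⟩))
      (Metric.mem_ball_self hη) (Metric.mem_ball.2 hwy)
    rw [dist_eq_norm] at hwy
    have h2 := norm_le_norm_add_norm_sub' (D w) (D y)
    have h3 := hDK y hy
    have h4 : (ε : ℝ) * ‖w - y‖ ≤ ε * η := mul_le_mul_of_nonneg_left hwy.le ε.2
    linarith
  have hE : ContDiff ℝ 1 (fun w => χ w • D w) := hχ.smul hD
  have hpos : 0 ≤ 2 * (ε : ℝ) * η := by positivity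
  refine ⟨fun w => χ w • D w, hE, fun w hw => ?_, fun w => ?_, ?_⟩
  · simp only [hχK w hw, one_smul]
  · by_cases hw : w ∈ Metric.thickening η K
    · rw [norm_smul, Real.norm_eq_abs]
      exact (mul_le_of_le_one_left (norm_nonneg _) (hχ1 w)).trans (hbd w hw)
    · simpa [(hχout w hw).1] using hpos
  · refine lipschitzWith_of_nnnorm_fderiv_le (𝕜 := ℝ) (hE.differentiable (by simp)) fun w => ?_
    rw [← NNReal.coe_le_coe, coe_nnnorm]
    have h1 : HasFDerivAt (fun w => χ w • D w) _ w :=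
      (hχ.differentiable (by simp)).differentiableAt.hasFDerivAt.smul
        (hD.differentiable (by simp)).differentiableAt.hasFDerivAt
    rw [h1.fderiv]
    push_cast
    by_cases hw : w ∈ Metric.thickening η K
    · refine (norm_add_le _ _).trans ?_
      have h2 : ‖χ w • fderiv ℝ D w‖ ≤ ε := by
        rw [norm_smul, Real.norm_eq_abs]
        exact (mul_le_of_le_one_left (norm_nonneg _) (hχ1 w)).trans (hD' w hw)
      -- The gradient `4 / η` of the cutoff meets values of size `2 ε η`; with the term `χ • D'`
      -- this totals `9 ε`.
      have h3 : ‖(fderiv ℝ χ w).smulRight (D w)‖ ≤ 8 * ε := by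
        rw [ContinuousLinearMap.norm_smulRight_apply]
        calc ‖fderiv ℝ χ w‖ * ‖D w‖ ≤ 4 / η * (2 * ε * η) :=
              mul_le_mul (hχ' w) (hbd w hw) (norm_nonneg _) (by positivity)
          _ = 8 * ε := by field_simp; ring
      linarith
    · rw [(hχout w hw).1, (hχout w hw).2]
      simp

end

/-! ### Moving along a path of layers -/

/-- The tube lemma. Only the compactness of `K` gives uniformity, since bounded sets of `X` need not
be relatively compact. -/
lemma eventually_forall_thickening_norm_lt {X F : Type*} [PseudoMetricSpace X]
    [NormedAddCommGroup F] {φ : ℝ × X → F}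
    (hφ : Continuous φ) {t : ℝ} (ht : ∀ w, φ (t, w) = 0) {K : Set X} (hK : IsCompact K) {ε : ℝ}
    (hε : 0 < ε) :
    ∃ η > 0, ∀ᶠ s in 𝓝 t, ∀ w ∈ Metric.thickening η K, ‖φ (s, w)‖ < ε := by
  have hopen : IsOpen {p : ℝ × X | ‖φ p‖ < ε} := isOpen_lt hφ.norm continuous_const
  obtain ⟨U, W, hU, hW, htU, hKW, hUW⟩ := generalized_tube_lemma (isCompact_singleton (x := t)) hK
    hopen (by
      rintro ⟨s, w⟩ ⟨hs, _⟩
      rw [Set.mem_singleton_iff] at hs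
      simp only at hs
      subst hs
      simpa [ht] using hε)
  obtain ⟨η, hη, hηW⟩ := hK.exists_thickening_subset_open hW hKW
  refine ⟨η, hη, ?_⟩
  filter_upwards [hU.mem_nhds (htU rfl)] with s hs w hw
  exact hUW ⟨hs, hηW hw⟩

section
variable {X : Type*} [NormedAddCommGroup X] [InnerProductSpace ℝ X] [CompleteSpace X]

/-- Two nearby members of a continuous family of invertible layers differ, on a ball, by an
elementary layer. -/
lemma eventually_reachable {T₁ T₂ : X →L[ℝ] X} (hT₁ : IsCompactOperator T₁)
    (hT₂ : IsCompactOperator T₂) {G : ℝ → X → X} (hG : ∀ s, ContDiff ℝ 1 (G s))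
    (hG0 : ∀ s, G s 0 = 0) (hcont : Continuous fun p : ℝ × X => fderiv ℝ (G p.1) p.2) {c : ℝ}
    (hc : 0 < c) {t : ℝ}
    (hlow : ∀ w v v', c * ‖v - v'‖ ≤
      ‖(v + T₂ (G t (w + T₁ v))) - (v' + T₂ (G t (w + T₁ v')))‖) (r : ℝ) :
    ∀ᶠ s in 𝓝 t,
      Reachable (Metric.ball 0 r) (fun x => x + T₂ (G t (T₁ x))) (fun x => x + T₂ (G s (T₁ x))) ∧
      Reachable (Metric.ball 0 r) (fun x => x + T₂ (G s (T₁ x)))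
        (fun x => x + T₂ (G t (T₁ x))) := by
  obtain ⟨V, hV, hVz⟩ := exists_contDiff_zero hT₁ (hG t) hc hlow
  obtain ⟨R, hR0, hR⟩ : ∃ R : ℝ, 0 ≤ R ∧ ∀ x ∈ Metric.ball (0 : X) r,
      ‖x + T₂ (G t (T₁ x))‖ ≤ R := by
    obtain ⟨A, hA⟩ := ((compactMap_comp_compactOperator (T₂ := T₂) hT₁ (hG t).continuous).2 _
      (Metric.isBounded_ball (x := (0 : X)) (r := r))).isBounded.exists_norm_le
    refine ⟨max 0 (r + A), le_max_left _ _, fun x hx => le_max_of_le_right ?_⟩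
    refine (norm_add_le _ _).trans (add_le_add (mem_ball_zero_iff.1 hx).le ?_)
    exact hA _ (subset_closure ⟨x, hx, rfl⟩)
  let K : Set X := closure (T₁ '' Metric.closedBall 0 R)
  have hK : IsCompact K :=
    IsCompactOperator.isCompact_closure_image_closedBall (f := (T₁ : X →ₗ[ℝ] X)) hT₁ R
  have hconv : Convex ℝ K :=
    ((convex_closedBall (0 : X) R).linear_image (T₁ : X →ₗ[ℝ] X)).closure
  have h0K : (0 : X) ∈ K := subset_closure ⟨0, Metric.mem_closedBall_self hR0, map_zero T₁⟩
  obtain ⟨A, hA0, hA⟩ := hK.isBounded.exists_pos_norm_le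
  -- `Ψ` recovers `T₁ x` from `T₁` of the output of layer `t`. The compact set `K` contains all such
  -- values for `x` in the ball.
  let Ψ : X → X := fun w => w + T₁ (V w)
  have hΨ : ContDiff ℝ 1 Ψ := contDiff_id.add (T₁.contDiff.comp hV)
  have hΨ0 : Ψ 0 = 0 := by
    have : (0 : X) = V 0 := (hVz 0 0).1 (by simp [hG0])
    simp [Ψ, ← this]
  let φ : ℝ × X → (X →L[ℝ] X) := fun p =>
    (fderiv ℝ (G p.1) (Ψ p.2) - fderiv ℝ (G t) (Ψ p.2)) ∘L fderiv ℝ Ψ p.2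
  have hφ : Continuous φ := by
    have h1 : Continuous fun p : ℝ × X => fderiv ℝ (G p.1) (Ψ p.2) :=
      hcont.comp (continuous_fst.prodMk (hΨ.continuous.comp continuous_snd))
    have h2 : Continuous fun p : ℝ × X => fderiv ℝ (G t) (Ψ p.2) :=
      hcont.comp (continuous_const.prodMk (hΨ.continuous.comp continuous_snd))
    exact (h1.sub h2).clm_comp ((hΨ.continuous_fderiv (by simp)).comp continuous_snd)
  have hφt : ∀ w, φ (t, w) = 0 := fun w => by simp [φ]
  -- Chosen so that the Lipschitz constant `9 ε` of the cutoff map, multiplied by `‖T₁‖ ‖T₂‖`, stays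
  -- below `1 / 2`.
  let ε : NNReal := (18 * (‖T₁‖₊ * ‖T₂‖₊ + 1))⁻¹
  have hε : 0 < ε := by positivity
  -- The width `η` is fixed first, by the derivative bound. The second, finer bound then makes the
  -- values of `D` at most `ε η` on `K`, by the mean value inequality from `0`, where `D` vanishes.
  obtain ⟨η, hη, hev⟩ := eventually_forall_thickening_norm_lt hφ hφt hK (NNReal.coe_pos.2 hε)
  obtain ⟨η', hη', hev'⟩ := eventually_forall_thickening_norm_lt hφ hφt hK
    (ε := ε * η / A) (by positivity)
  filter_upwards [hev, hev'] with s hs hs'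
  let D : X → X := fun w => G s (Ψ w) - G t (Ψ w)
  have hD : ContDiff ℝ 1 D := ((hG s).comp hΨ).sub ((hG t).comp hΨ)
  have hDφ : ∀ w, fderiv ℝ D w = φ (s, w) := by
    intro w
    have h1 : ∀ s, HasFDerivAt (fun w => G s (Ψ w)) _ w := fun s =>
      ((hG s).differentiable (by simp)).differentiableAt.hasFDerivAt.comp w
        (hΨ.differentiable (by simp)).differentiableAt.hasFDerivAt
    have h2 : HasFDerivAt D _ w := (h1 s).sub (h1 t)
    rw [h2.fderiv]
    simp [φ, ContinuousLinearMap.sub_comp]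
  have hD0 : D 0 = 0 := by simp [D, hΨ0, hG0]
  have hDK : ∀ w ∈ K, ‖D w‖ ≤ ε * η := by
    intro w hw
    have h1 := hconv.norm_image_sub_le_of_norm_fderiv_le (𝕜 := ℝ) (f := D) (C := ε * η / A)
      (fun x _ => (hD.differentiable (by simp)).differentiableAt)
      (fun x hx => by
        rw [hDφ]
        exact (hs' x (Metric.self_subset_thickening hη' K hx)).le) h0K hw
    rw [hD0, sub_zero, sub_zero] at h1
    refine h1.trans ?_
    rw [div_mul_eq_mul_div, div_le_iff₀ hA0]
    exact mul_le_mul_of_nonneg_left (hA w hw) (by positivity)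
  obtain ⟨E, hE, hEK, hEb, hEL⟩ := exists_lipschitz_eqOn_compact ⟨0, h0K⟩ hK hconv hη hD hDK
    (fun w hw => by rw [hDφ]; exact (hs w hw).le)
  have hB : ElementaryLayer (1 / 2) (fun x => T₂ (E (T₁ x))) := by
    refine ⟨T₁, T₂, E, hT₁, hT₂, hE, ⟨(2 * ε * η).toNNReal + 9 * ε, fun x => ?_, ?_⟩,
      fun w u => ?_, fun x => rfl⟩
    · refine (hEb x).trans ?_
      rw [NNReal.coe_add, Real.coe_toNNReal _ (by positivity)]
      exact le_add_of_nonneg_right (NNReal.coe_nonneg _)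
    · exact hEL.weaken le_add_self
    · rw [← map_sub]
      have h1 := hEL.dist_le_mul (w + T₁ u) w
      rw [dist_eq_norm, dist_eq_norm, add_sub_cancel_left] at h1
      have h2 : ‖T₁‖ * ‖T₂‖ * (9 * ε) ≤ 1 / 2 := by
        simp only [ε]
        push_cast
        rw [← mul_assoc, ← div_eq_mul_inv, div_le_iff₀ (by positivity)]
        linarith
      calc ‖T₂ (E (w + T₁ u) - E w)‖ ≤ ‖T₂‖ * ((9 * ε : NNReal) * (‖T₁‖ * ‖u‖)) := by
            refine (T₂.le_opNorm _).trans ?_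
            gcongr
            exact h1.trans (by gcongr; exact T₁.le_opNorm u)
        _ = ‖T₁‖ * ‖T₂‖ * (9 * ε) * ‖u‖ := by push_cast; ring
        _ ≤ 1 / 2 * ‖u‖ := by gcongr
  have hmem : ∀ x ∈ Metric.ball (0 : X) r,
      x + T₂ (G s (T₁ x)) = (x + T₂ (G t (T₁ x))) + T₂ (E (T₁ (x + T₂ (G t (T₁ x))))) := by
    intro x hx
    have h1 : T₁ (x + T₂ (G t (T₁ x))) ∈ K :=
      subset_closure ⟨_, mem_closedBall_zero_iff.2 (hR x hx), rfl⟩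
    have h2 : -T₂ (G t (T₁ x)) = V (T₁ (x + T₂ (G t (T₁ x)))) := by
      refine (hVz _ _).1 ?_
      rw [← map_add, add_neg_cancel_right, neg_add_cancel]
    have h3 : Ψ (T₁ (x + T₂ (G t (T₁ x)))) = T₁ x := by
      simp only [Ψ]
      rw [← h2, ← map_add, add_neg_cancel_right]
    rw [hEK _ h1]
    simp only [D, h3, map_sub]
    abel
  have hmaps : ∀ x ∈ Metric.ball (0 : X) r, x + T₂ (G t (T₁ x)) ∈ (Set.univ : Set X) :=
    fun _ _ => Set.mem_univ _
  exact ⟨((hB.reachable Set.univ).precomp hmaps).congr (fun _ _ => rfl) hmem,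
    ((hB.reachable_symm Set.univ).precomp hmaps).congr hmem (fun _ _ => rfl)⟩

/-- The endpoints of a continuous path of invertible layers are reachable from each other. -/
lemma reachable_of_path {T₁ T₂ : X →L[ℝ] X} (hT₁ : IsCompactOperator T₁)
    (hT₂ : IsCompactOperator T₂) {G : ℝ → X → X} (hG : ∀ s, ContDiff ℝ 1 (G s))
    (hG0 : ∀ s, G s 0 = 0) (hcont : Continuous fun p : ℝ × X => fderiv ℝ (G p.1) p.2)
    (hlow : ∀ t, ∃ c > 0, ∀ w v v', c * ‖v - v'‖ ≤
      ‖(v + T₂ (G t (w + T₁ v))) - (v' + T₂ (G t (w + T₁ v')))‖) (r a b : ℝ) :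
    Reachable (Metric.ball 0 r) (fun x => x + T₂ (G a (T₁ x))) (fun x => x + T₂ (G b (T₁ x))) := by
  have hloc : ∀ t, ∀ᶠ s in 𝓝 t, _ := fun t => by
    obtain ⟨c, hc, h⟩ := hlow t
    exact eventually_reachable hT₁ hT₂ hG hG0 hcont hc h r
  -- Openness uses the forward half of the local statement, closedness the backward half.
  let S : Set ℝ := {t | Reachable (Metric.ball 0 r) (fun x => x + T₂ (G a (T₁ x)))
    (fun x => x + T₂ (G t (T₁ x)))}
  have hopen : IsOpen S := isOpen_iff_mem_nhds.2 fun t (ht : Reachable _ _ _) => by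
    filter_upwards [hloc t] with s hs
    exact ht.trans hs.1
  have hclosed : IsClosed S := by
    rw [← isOpen_compl_iff, isOpen_iff_mem_nhds]
    intro t ht
    filter_upwards [hloc t] with s hs hsS
    exact ht (Reachable.trans hsS hs.2)
  have huniv : S = Set.univ := IsClopen.eq_univ ⟨hclosed, hopen⟩ ⟨a, Reachable.refl _ _⟩
  have hb : b ∈ S := huniv ▸ Set.mem_univ b
  exact hb

end

/-! ### Linear layers and rank one factors -/

/-- On every ball, the linear map `A` is a composition of elementary layers. -/
def ReachableFromId {X : Type*} [NormedAddCommGroup X] [InnerProductSpace ℝ X]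
    (A : X →L[ℝ] X) : Prop :=
  ∀ r : ℝ, Reachable (Metric.ball 0 r) id A

/-- The rank one perturbation `x ↦ x + φ x • a` of the identity. -/
noncomputable def rankOneUpdate {X : Type*} [NormedAddCommGroup X] [InnerProductSpace ℝ X] (a : X)
    (φ : X →L[ℝ] ℝ) : X →L[ℝ] X :=
  ContinuousLinearMap.id ℝ X + φ.smulRight a

section
variable {X : Type*} [NormedAddCommGroup X] [InnerProductSpace ℝ X]

lemma rankOneUpdate_apply (a : X) (φ : X →L[ℝ] ℝ) (x : X) :
    rankOneUpdate a φ x = x + φ x • a := rfl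

lemma rankOneUpdate_comp_of_eq_functional (a b : X) (φ : X →L[ℝ] ℝ) :
    rankOneUpdate a φ ∘L rankOneUpdate b φ = rankOneUpdate (b + (1 + φ b) • a) φ := by
  ext x
  simp only [ContinuousLinearMap.comp_apply, rankOneUpdate_apply, map_add, map_smul]
  module

lemma rankOneUpdate_comp_of_eq_vector (a : X) (φ ψ : X →L[ℝ] ℝ) :
    rankOneUpdate a φ ∘L rankOneUpdate a ψ = rankOneUpdate a (φ + (1 + φ a) • ψ) := by
  ext x
  simp only [ContinuousLinearMap.comp_apply, rankOneUpdate_apply, map_add, map_smul, smul_eq_mul,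
    add_apply, smul_apply]
  module

lemma rankOneUpdate_comp_self {a : X} {φ : X →L[ℝ] ℝ} (h : φ a = -2) :
    rankOneUpdate a φ ∘L rankOneUpdate a φ = ContinuousLinearMap.id ℝ X := by
  rw [rankOneUpdate_comp_of_eq_functional, h]
  ext x
  rw [rankOneUpdate_apply]
  norm_num

lemma rankOneUpdate_comp_inverse {a : X} {φ : X →L[ℝ] ℝ} (h : 1 + φ a ≠ 0) :
    rankOneUpdate a φ ∘L rankOneUpdate (-(1 + φ a)⁻¹ • a) φ = ContinuousLinearMap.id ℝ X := by
  rw [rankOneUpdate_comp_of_eq_functional]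
  have : -(1 + φ a)⁻¹ • a + (1 + φ (-(1 + φ a)⁻¹ • a)) • a = 0 := by
    rw [← add_smul, map_smul, smul_eq_mul]
    have : -(1 + φ a)⁻¹ + (1 + -(1 + φ a)⁻¹ * φ a) = 0 := by field_simp; ring
    rw [this, zero_smul]
  rw [this]
  ext x
  simp [rankOneUpdate_apply]

lemma rankOneUpdate_inverse_comp {a : X} {φ : X →L[ℝ] ℝ} (h : 1 + φ a ≠ 0) :
    rankOneUpdate (-(1 + φ a)⁻¹ • a) φ ∘L rankOneUpdate a φ = ContinuousLinearMap.id ℝ X := by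
  rw [rankOneUpdate_comp_of_eq_functional]
  have : a + (1 + φ a) • -(1 + φ a)⁻¹ • a = 0 := by
    rw [smul_smul, mul_neg, mul_inv_cancel₀ h, neg_one_smul, add_neg_cancel]
  rw [this]
  ext x
  simp [rankOneUpdate_apply]

lemma isCompactOperator_smulRight (φ : X →L[ℝ] ℝ) (a : X) :
    IsCompactOperator (φ.smulRight a : X →L[ℝ] X) :=
  (isCompactOperator_of_locallyCompactSpace_dom φ).clm_comp
    ((ContinuousLinearMap.id ℝ ℝ).smulRight a)

lemma ContinuousLinearMap.mapsTo_ball (A : X →L[ℝ] X) (r : ℝ) :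
    ∀ x ∈ Metric.ball (0 : X) r, A x ∈ Metric.ball (0 : X) (‖A‖ * |r| + 1) := by
  intro x hx
  rw [mem_ball_zero_iff] at hx ⊢
  have h1 := A.le_opNorm x
  have h2 : ‖A‖ * ‖x‖ ≤ ‖A‖ * |r| :=
    mul_le_mul_of_nonneg_left (hx.le.trans (le_abs_self r)) (norm_nonneg A)
  linarith

lemma ReachableFromId.id : ReachableFromId (ContinuousLinearMap.id ℝ X) := fun _ =>
  Reachable.refl _ _

lemma ReachableFromId.comp {A A' : X →L[ℝ] X} (hA : ReachableFromId A)
    (hA' : ReachableFromId A') : ReachableFromId (A ∘L A') := fun r =>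
  (hA' r).trans ((hA (‖A'‖ * |r| + 1)).precomp (A'.mapsTo_ball r))

/-- Approximation of a compact operator by finite dimensional projections. -/
lemma exists_projection_norm_sub_le {C : X →L[ℝ] X} (hC : IsCompactOperator C) {ε : ℝ}
    (hε : 0 < ε) : ∃ P : X →L[ℝ] X, FiniteDimensional ℝ (LinearMap.range (P : X →ₗ[ℝ] X)) ∧
      ∀ x, ‖P (C x) - C x‖ ≤ ε * ‖x‖ := by
  have hcomp : IsCompact (closure (C '' Metric.closedBall 0 1)) :=
    IsCompactOperator.isCompact_closure_image_closedBall (f := (C : X →ₗ[ℝ] X)) hC 1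
  obtain ⟨t, ht, hcov⟩ := Metric.totallyBounded_iff.1 hcomp.totallyBounded ε hε
  let W : Submodule ℝ X := Submodule.span ℝ t
  have hW : FiniteDimensional ℝ W := FiniteDimensional.span_of_finite ℝ ht
  refine ⟨W.starProjection, ?_, fun x => ?_⟩
  · refine Submodule.finiteDimensional_of_le (S₂ := W) ?_
    rintro _ ⟨x, rfl⟩
    exact Submodule.starProjection_apply_mem W x
  · rcases eq_or_ne x 0 with rfl | hx
    · simp
    have hx' : 0 < ‖x‖ := norm_pos_iff.2 hx
    have h1 : C (‖x‖⁻¹ • x) ∈ closure (C '' Metric.closedBall 0 1) := by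
      refine subset_closure ⟨_, ?_, rfl⟩
      rw [mem_closedBall_zero_iff, norm_smul, norm_inv, norm_norm, inv_mul_cancel₀ hx'.ne']
    obtain ⟨y, hy, hxy⟩ := Set.mem_iUnion₂.1 (hcov h1)
    rw [Metric.mem_ball, dist_eq_norm] at hxy
    have h2 : ‖W.starProjection (C (‖x‖⁻¹ • x)) - C (‖x‖⁻¹ • x)‖ ≤ ε := by
      rw [norm_sub_rev, Submodule.starProjection_minimal]
      refine (ciInf_le ⟨0, ?_⟩ (⟨y, Submodule.subset_span hy⟩ : W)).trans hxy.le
      rintro _ ⟨z, rfl⟩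
      exact norm_nonneg _
    rw [map_smul, map_smul, ← smul_sub, norm_smul, norm_inv, norm_norm,
      inv_mul_le_iff₀ hx'] at h2
    linarith

variable [CompleteSpace X]

/-- Along a linear path, injectivity already gives a lower bound through the bounded Fredholm
inverse, and the translation by `w` drops out of differences. -/
lemma reachable_of_injective_segment {T₁ T₂ : X →L[ℝ] X} (hT₁ : IsCompactOperator T₁)
    (hT₂ : IsCompactOperator T₂) (D D' : X →L[ℝ] X)
    (hinj : ∀ s : ℝ, 0 ≤ s → s ≤ 1 → ∀ x, x + T₂ ((D + s • (D' - D)) (T₁ x)) = 0 → x = 0) (r : ℝ) :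
    Reachable (Metric.ball 0 r) (fun x => x + T₂ (D (T₁ x))) (fun x => x + T₂ (D' (T₁ x))) := by
  -- The parameter is clamped to `[0, 1]` because paths are indexed by all of `ℝ`.
  let L : ℝ → (X →L[ℝ] X) := fun s => D + (max 0 (min 1 s)) • (D' - D)
  have hL : Continuous L := by fun_prop
  have h := reachable_of_path hT₁ hT₂ (G := fun s => L s) (fun s => (L s).contDiff)
    (fun s => map_zero _) (by
      simp only [ContinuousLinearMap.fderiv]
      exact hL.comp continuous_fst) (fun t => ?_) r 0 1
  · simpa [L] using h
  · obtain ⟨e, he⟩ := exists_equiv_of_injective_id_add_compact (T₂ ∘L L t ∘L T₁)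
      (hT₁.clm_comp (T₂ ∘L L t) :) (hinj _ (le_max_left _ _)
        (max_le zero_le_one (min_le_left _ _)))
    refine ⟨(‖(e.symm : X →L[ℝ] X)‖ + 1)⁻¹, by positivity, fun w v v' => ?_⟩
    have h1 : (v + T₂ (L t (w + T₁ v))) - (v' + T₂ (L t (w + T₁ v'))) = e (v - v') := by
      rw [he]
      simp only [ContinuousLinearMap.comp_apply, map_add, map_sub]
      abel
    rw [h1, inv_mul_le_iff₀ (by positivity)]
    calc ‖v - v'‖ = ‖(e.symm : X →L[ℝ] X) (e (v - v'))‖ := by simp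
      _ ≤ ‖(e.symm : X →L[ℝ] X)‖ * ‖e (v - v')‖ := ContinuousLinearMap.le_opNorm _ _
      _ ≤ _ := by gcongr; linarith

/-- The determinant `1 + s φ a` stays positive for `s` in `[0, 1]`, so the segment from the identity
consists of invertible maps. -/
lemma reachableFromId_rankOneUpdate {a : X} {φ : X →L[ℝ] ℝ} (h : 0 < 1 + φ a) :
    ReachableFromId (rankOneUpdate a φ) := by
  intro r
  rcases eq_or_ne a 0 with rfl | ha
  · exact (Reachable.refl _ _).congr (fun _ _ => rfl) fun x _ => by
      simp [rankOneUpdate_apply]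
  have ha' : (inner ℝ a a : ℝ) ≠ 0 := by simpa using ha
  have hT : ∀ x, ((innerSL ℝ a).smulRight a) (φ.smulRight ((inner ℝ a a : ℝ)⁻¹ • a) x) =
      φ x • a := by
    intro x
    simp only [ContinuousLinearMap.smulRight_apply, innerSL_apply_apply, inner_smul_right]
    rw [inv_mul_cancel₀ ha', mul_one]
  have h1 := reachable_of_injective_segment
    (isCompactOperator_smulRight φ ((inner ℝ a a : ℝ)⁻¹ • a))
    (isCompactOperator_smulRight (innerSL ℝ a) a) 0 (ContinuousLinearMap.id ℝ X) ?_ r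
  · refine h1.congr (fun x _ => by simp) fun x _ => ?_
    rw [ContinuousLinearMap.id_apply, hT, rankOneUpdate_apply]
  · intro s hs0 hs1 x hx
    have h2 : x + s • φ x • a = 0 := by
      have e1 : ∀ y : X, (0 + s • (ContinuousLinearMap.id ℝ X - 0)) y = s • y := fun y => by simp
      rwa [e1, map_smul, hT] at hx
    have h3 := congrArg φ h2
    simp only [map_add, map_smul, smul_eq_mul, map_zero] at h3
    have h4 : φ x * (1 + s * φ a) = 0 := by linarith
    have h5 : 1 + s * φ a ≠ 0 := by
      rcases le_total 0 (φ a) with h0 | h0 <;> nlinarith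
    rw [(mul_eq_zero.1 h4).resolve_right h5] at h2
    simpa using h2

/-- A reflection with vector along `b` and functional along `φ` is inserted twice. It shares its
functional with the left factor and its vector with the right one, so both products are rank one
updates, each of positive determinant. -/
lemma reachableFromId_comp_of_apply_ne_zero {a b : X} {φ ψ : X →L[ℝ] ℝ} (ha : 1 + φ a < 0)
    (hb : 1 + ψ b < 0) (hφb : φ b ≠ 0) :
    ReachableFromId (rankOneUpdate a φ ∘L rankOneUpdate b ψ) := by
  let l : ℝ := -2 / φ b
  have hl : φ (l • b) = -2 := by simp [l, hφb]
  have e1 : rankOneUpdate (l • b) φ = rankOneUpdate b (l • φ) := by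
    ext x
    simp only [rankOneUpdate_apply, smul_apply, smul_eq_mul]
    module
  have hlb : (l • φ) b = -2 := by simpa using hl
  have e2 : rankOneUpdate a φ ∘L rankOneUpdate b ψ =
      (rankOneUpdate a φ ∘L rankOneUpdate (l • b) φ) ∘L
        (rankOneUpdate b (l • φ) ∘L rankOneUpdate b ψ) := by
    rw [ContinuousLinearMap.comp_assoc, ← ContinuousLinearMap.comp_assoc (rankOneUpdate (l • b) φ),
      ← e1, rankOneUpdate_comp_self hl, ContinuousLinearMap.id_comp]
  rw [e2]
  refine .comp ?_ ?_
  · rw [rankOneUpdate_comp_of_eq_functional]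
    refine reachableFromId_rankOneUpdate ?_
    rw [map_add, hl, map_smul, smul_eq_mul]
    linarith
  · rw [rankOneUpdate_comp_of_eq_vector]
    refine reachableFromId_rankOneUpdate ?_
    rw [add_apply, hlb, smul_apply, smul_eq_mul]
    linarith

/-- The product of two rank one perturbations of the identity of negative determinant. -/
lemma reachableFromId_comp_of_neg {a b : X} {φ ψ : X →L[ℝ] ℝ} (ha : 1 + φ a < 0)
    (hb : 1 + ψ b < 0) : ReachableFromId (rankOneUpdate a φ ∘L rankOneUpdate b ψ) := by
  by_cases hφb : φ b = 0
  -- If `φ b = 0`, an intermediate reflection with vector `a` and functional along `χ` puts both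
  -- products in the previous case.
  · obtain ⟨χ, hχa, hχb⟩ : ∃ χ : X →L[ℝ] ℝ, χ a ≠ 0 ∧ χ b ≠ 0 := by
      by_cases hψa : ψ a = 0
      · refine ⟨φ + ψ, ?_, ?_⟩
        · rw [add_apply, hψa]; linarith
        · rw [add_apply, hφb]; linarith
      · exact ⟨ψ, hψa, by linarith⟩
    let l : ℝ := -2 / χ a
    have hl : (l • χ) a = -2 := by simp [l, hχa]
    have hl0 : l ≠ 0 := div_ne_zero (by norm_num) hχa
    have e2 : rankOneUpdate a φ ∘L rankOneUpdate b ψ =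
        (rankOneUpdate a φ ∘L rankOneUpdate a (l • χ)) ∘L
          (rankOneUpdate a (l • χ) ∘L rankOneUpdate b ψ) := by
      rw [ContinuousLinearMap.comp_assoc,
        ← ContinuousLinearMap.comp_assoc (rankOneUpdate a (l • χ)),
        rankOneUpdate_comp_self hl, ContinuousLinearMap.id_comp]
    rw [e2]
    refine .comp (reachableFromId_comp_of_apply_ne_zero ha ?_ (by linarith))
      (reachableFromId_comp_of_apply_ne_zero ?_ hb ?_)
    · rw [hl]; norm_num
    · rw [hl]; norm_num
    · rw [smul_apply, smul_eq_mul]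
      exact mul_ne_zero hl0 hχb
  · exact reachableFromId_comp_of_apply_ne_zero ha hb hφb

/-- Parity of the sign: a factor of negative determinant switches the alternative, a positive one
keeps it. Conjugation by the reflection preserves `φ a`, hence the determinant. -/
lemma reachableFromId_comp_rankOneUpdate {M : X →L[ℝ] X} {a e : X} {φ χ : X →L[ℝ] ℝ}
    (hχ : χ e = -2) (hM : ReachableFromId M ∨ ReachableFromId (M ∘L rankOneUpdate e χ))
    (hφ : 1 + φ a ≠ 0) :
    ReachableFromId (M ∘L rankOneUpdate a φ) ∨
      ReachableFromId ((M ∘L rankOneUpdate a φ) ∘L rankOneUpdate e χ) := by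
  have hR := rankOneUpdate_comp_self hχ
  have hR' : ∀ A : X →L[ℝ] X, rankOneUpdate e χ ∘L (rankOneUpdate e χ ∘L A) = A := fun A => by
    rw [← ContinuousLinearMap.comp_assoc, hR, ContinuousLinearMap.id_comp]
  have hneg : 1 + χ e < 0 := by rw [hχ]; norm_num
  rcases hφ.lt_or_gt with h | h <;> rcases hM with hM | hM
  · right
    rw [ContinuousLinearMap.comp_assoc]
    exact hM.comp (reachableFromId_comp_of_neg h hneg)
  · left
    have := hM.comp (reachableFromId_comp_of_neg hneg h)
    rwa [ContinuousLinearMap.comp_assoc, hR'] at this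
  · exact Or.inl (hM.comp (reachableFromId_rankOneUpdate h))
  · right
    have e1 : rankOneUpdate e χ ∘L rankOneUpdate a φ ∘L rankOneUpdate e χ =
        rankOneUpdate (rankOneUpdate e χ a) (φ ∘L rankOneUpdate e χ) := by
      ext x
      have h1 : rankOneUpdate e χ (rankOneUpdate e χ x) = x := congrArg (fun A => A x) hR
      simp only [ContinuousLinearMap.comp_apply, rankOneUpdate_apply a φ, map_add, map_smul, h1]
      rfl
    have h1 : rankOneUpdate e χ (rankOneUpdate e χ a) = a := congrArg (fun A => A a) hR
    have h2 : ReachableFromId (rankOneUpdate e χ ∘L rankOneUpdate a φ ∘L rankOneUpdate e χ) := by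
      rw [e1]
      refine reachableFromId_rankOneUpdate ?_
      rwa [ContinuousLinearMap.comp_apply, h1]
    have := hM.comp h2
    rwa [ContinuousLinearMap.comp_assoc, hR', ← ContinuousLinearMap.comp_assoc] at this

/-- An invertible finite rank perturbation of the identity is, up to a fixed reflection, a
composition of elementary layers on every ball. -/
lemma reachableFromId_of_finite_rank {e : X} {χ : X →L[ℝ] ℝ} (hχ : χ e = -2) (n : ℕ) :
    ∀ K : X →L[ℝ] X, FiniteDimensional ℝ (LinearMap.range (K : X →ₗ[ℝ] X)) →
      Module.finrank ℝ (LinearMap.range (K : X →ₗ[ℝ] X)) ≤ n →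
      Function.Bijective (ContinuousLinearMap.id ℝ X + K) →
      ReachableFromId (ContinuousLinearMap.id ℝ X + K) ∨
        ReachableFromId ((ContinuousLinearMap.id ℝ X + K) ∘L rankOneUpdate e χ) := by
  induction n with
  | zero =>
    intro K hfin hrank _
    left
    have h1 : LinearMap.range (K : X →ₗ[ℝ] X) = ⊥ := by
      rw [← Submodule.finrank_eq_zero (R := ℝ)]
      omega
    have h2 : K = 0 := by
      ext x
      have : K x ∈ LinearMap.range (K : X →ₗ[ℝ] X) := ⟨x, rfl⟩
      rw [h1] at this
      simpa using this
    rw [h2, add_zero]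
    exact .id
  | succ n ih =>
    intro K hfin hrank hbij
    by_cases hK : K = 0
    · left
      rw [hK, add_zero]
      exact .id
    obtain ⟨x₀, hx₀⟩ : ∃ x, K x ≠ 0 := by
      by_contra! h
      exact hK (ContinuousLinearMap.ext h)
    obtain ⟨w, hw⟩ := hbij.2 (K x₀)
    have hw' : w + K w = K x₀ := hw
    have hw0 : w ≠ 0 := by
      rintro rfl
      simp only [map_zero, add_zero] at hw'
      exact hx₀ hw'.symm
    -- Multiplying `Id + K` by the update of vector `-w` and functional `ψ ∘ K` subtracts `ψ (K x) •
    -- K x₀`, which pushes the range into the kernel of `ψ` and so lowers the rank. The determinant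
    -- of the update is `ψ w`, hence the requirement `ψ w ≠ 0`.
    obtain ⟨ψ, hψ1, hψw⟩ : ∃ ψ : X →L[ℝ] ℝ, ψ (K x₀) = 1 ∧ ψ w ≠ 0 := by
      obtain ⟨y, hy1, hy2⟩ : ∃ y : X, inner ℝ y (K x₀) ≠ (0 : ℝ) ∧ inner ℝ y w ≠ (0 : ℝ) := by
        by_cases h : inner ℝ (K x₀) w = (0 : ℝ)
        · refine ⟨K x₀ + w, ?_, ?_⟩
          · rw [inner_add_left, real_inner_comm, real_inner_comm (K x₀) w, h]
            simpa using hx₀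
          · rw [inner_add_left, h]
            simpa using hw0
        · exact ⟨K x₀, by simpa using hx₀, h⟩
      refine ⟨(inner ℝ y (K x₀) : ℝ)⁻¹ • innerSL ℝ y, ?_, ?_⟩
      · simp [hy1]
      · simpa using ⟨hy1, hy2⟩
    let φ : X →L[ℝ] ℝ := ψ ∘L K
    have hdet : 1 + φ (-w) = ψ w := by
      have h1 := congrArg ψ hw'
      rw [map_add, hψ1] at h1
      simp only [φ, ContinuousLinearMap.comp_apply, map_neg]
      linarith
    have hdet0 : 1 + φ (-w) ≠ 0 := hdet ▸ hψw
    let K' : X →L[ℝ] X := K - (ψ ∘L K).smulRight (K x₀)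
    have hAE : (ContinuousLinearMap.id ℝ X + K) ∘L rankOneUpdate (-w) φ =
        ContinuousLinearMap.id ℝ X + K' := by
      ext x
      simp only [ContinuousLinearMap.comp_apply, rankOneUpdate_apply, add_apply,
        ContinuousLinearMap.id_apply, K', sub_apply, ContinuousLinearMap.smulRight_apply, map_add,
        map_smul, map_neg, φ]
      rw [← hw']
      module
    have hsub : LinearMap.range (K' : X →ₗ[ℝ] X) < LinearMap.range (K : X →ₗ[ℝ] X) := by
      refine lt_of_le_of_ne ?_ fun heq => ?_
      · rintro _ ⟨x, rfl⟩
        refine ⟨x - ψ (K x) • x₀, ?_⟩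
        simp [K']
      · have hmem : K x₀ ∈ LinearMap.range (K' : X →ₗ[ℝ] X) := heq ▸ ⟨x₀, rfl⟩
        obtain ⟨z, hz⟩ := hmem
        have hz' : K z - ψ (K z) • K x₀ = K x₀ := hz
        have := congrArg ψ hz'
        rw [map_sub, map_smul, hψ1] at this
        simp at this
    have hfin' : FiniteDimensional ℝ (LinearMap.range (K' : X →ₗ[ℝ] X)) :=
      Submodule.finiteDimensional_of_le hsub.le
    have hrank' := Submodule.finrank_lt_finrank_of_lt hsub
    have hEbij : Function.Bijective (rankOneUpdate (-w) φ) :=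
      ⟨Function.LeftInverse.injective (g := rankOneUpdate (-(1 + φ (-w))⁻¹ • -w) φ) fun x =>
          congrArg (fun A => A x) (rankOneUpdate_inverse_comp hdet0),
        Function.RightInverse.surjective (g := rankOneUpdate (-(1 + φ (-w))⁻¹ • -w) φ) fun x =>
          congrArg (fun A => A x) (rankOneUpdate_comp_inverse hdet0)⟩
    have hbij' : Function.Bijective (ContinuousLinearMap.id ℝ X + K') := by
      rw [← hAE]
      exact hbij.comp hEbij
    have hIH := ih K' hfin' (by omega) hbij'
    have hdet1 : 1 + φ (-(1 + φ (-w))⁻¹ • -w) ≠ 0 := by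
      rw [map_smul, smul_eq_mul]
      have : 1 + -(1 + φ (-w))⁻¹ * φ (-w) = (1 + φ (-w))⁻¹ := by field_simp; ring
      rw [this]
      exact inv_ne_zero hdet0
    have hfinal := reachableFromId_comp_rankOneUpdate hχ hIH hdet1
    rwa [← hAE, ContinuousLinearMap.comp_assoc, rankOneUpdate_comp_inverse hdet0,
      ContinuousLinearMap.comp_id] at hfinal

/-- An invertible compact perturbation `Id + T₂ ∘ D ∘ T₁` of the identity is, up to a fixed
reflection, a composition of elementary layers on every ball. -/
lemma reachable_linear {T₁ T₂ : X →L[ℝ] X} (hT₁ : IsCompactOperator T₁)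
    (hT₂ : IsCompactOperator T₂) (D : X →L[ℝ] X) {c : ℝ} (hc : 0 < c)
    (hlow : ∀ x, c * ‖x‖ ≤ ‖x + T₂ (D (T₁ x))‖) {e : X} {χ : X →L[ℝ] ℝ} (hχ : χ e = -2) :
    (∀ r, Reachable (Metric.ball 0 r) id (fun x => x + T₂ (D (T₁ x)))) ∨
      ∀ r, Reachable (Metric.ball 0 r) (rankOneUpdate e χ) (fun x => x + T₂ (D (T₁ x))) := by
  have hC : IsCompactOperator (D ∘L T₁) := (hT₁.clm_comp D :)
  -- This accuracy costs at most `c / 2` of the lower bound along the whole segment from `P ∘ D` to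
  -- `D`.
  obtain ⟨P, hP, hPC⟩ := exists_projection_norm_sub_le hC (ε := c / (2 * (‖T₂‖ + 1)))
    (by positivity)
  let D' : X →L[ℝ] X := P ∘L D
  have hinj : ∀ s : ℝ, 0 ≤ s → s ≤ 1 → ∀ x, x + T₂ ((D' + s • (D - D')) (T₁ x)) = 0 → x = 0 := by
    intro s hs0 hs1 x hx
    have h1 : x + T₂ (D (T₁ x)) = -T₂ ((1 - s) • (P (D (T₁ x)) - D (T₁ x))) := by
      have h2 : (D' + s • (D - D')) (T₁ x) =
          D (T₁ x) + (1 - s) • (P (D (T₁ x)) - D (T₁ x)) := by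
        simp only [D', add_apply, smul_apply, sub_apply, ContinuousLinearMap.comp_apply]
        module
      rw [h2, map_add, ← add_assoc] at hx
      exact eq_neg_of_add_eq_zero_left hx
    have h3 := hlow x
    have h4 : ‖T₂ ((1 - s) • (P (D (T₁ x)) - D (T₁ x)))‖ ≤ c / 2 * ‖x‖ := by
      calc _ ≤ ‖T₂‖ * (1 * (c / (2 * (‖T₂‖ + 1)) * ‖x‖)) := by
            refine (T₂.le_opNorm _).trans ?_
            rw [norm_smul, Real.norm_eq_abs]
            gcongr
            · rw [abs_le]; constructor <;> linarith
            · exact hPC x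
        _ = ‖T₂‖ / (‖T₂‖ + 1) * (c / 2 * ‖x‖) := by field_simp
        _ ≤ c / 2 * ‖x‖ := by
            refine mul_le_of_le_one_left (by positivity) ?_
            rw [div_le_one (by positivity)]
            linarith
    rw [h1, norm_neg] at h3
    have h5 : c / 2 * ‖x‖ ≤ 0 := by linarith
    exact norm_le_zero_iff.1 (nonpos_of_mul_nonpos_right h5 (by positivity))
  have hreach := reachable_of_injective_segment hT₁ hT₂ D' D hinj
  let K : X →L[ℝ] X := T₂ ∘L D' ∘L T₁
  have hKfin : FiniteDimensional ℝ (LinearMap.range (K : X →ₗ[ℝ] X)) := by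
    refine Submodule.finiteDimensional_of_le
      (S₂ := (LinearMap.range (P : X →ₗ[ℝ] X)).map (T₂ : X →ₗ[ℝ] X)) ?_
    rintro _ ⟨x, rfl⟩
    exact ⟨P (D (T₁ x)), ⟨_, rfl⟩, rfl⟩
  obtain ⟨E, hE⟩ := exists_equiv_of_injective_id_add_compact K (hT₁.clm_comp (T₂ ∘L D') :)
    fun x hx => hinj 0 le_rfl zero_le_one x (by simpa [K] using hx)
  have hbij : Function.Bijective (ContinuousLinearMap.id ℝ X + K) := by
    have : ⇑(ContinuousLinearMap.id ℝ X + K) = E := by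
      funext x
      exact (hE x).symm
    rw [this]
    exact E.bijective
  rcases reachableFromId_of_finite_rank hχ _ K hKfin le_rfl hbij with h | h
  · exact Or.inl fun r => (h r).trans (hreach r)
  · right
    intro r
    have hR := rankOneUpdate_comp_self hχ
    have h1 := (h _).precomp ((rankOneUpdate e χ).mapsTo_ball r)
    refine Reachable.trans (h1.congr (fun _ _ => rfl) fun x _ => ?_) (hreach r)
    have h2 : rankOneUpdate e χ (rankOneUpdate e χ x) = x := congrArg (fun A => A x) hR
    change _ = (ContinuousLinearMap.id ℝ X + K) (rankOneUpdate e χ (rankOneUpdate e χ x))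
    rw [h2]
    rfl

end

/-! ### From the linear part to the layer, and the count -/

section
variable {X : Type*} [NormedAddCommGroup X] [InnerProductSpace ℝ X]

/-- With `N = ⌊1 / ε⌋ + 2` the constant `1 / N` is below both `ε` and `1`; the latter ensures strong
monotonicity even for large `ε`. -/
lemma Reachable.hasLayerFactorization {e : X} {F : X → X} {r : ℝ} (A₀ : X ≃L[ℝ] X)
    (hA₀ : (∀ x : X, A₀ x = x) ∨ (∀ x : X, A₀ x = x - (2 * inner ℝ x e) • e))
    (h : Reachable (Metric.ball 0 r) A₀ F) :
    ∃ C : ℕ, ∀ ε : ℝ, 0 < ε → HasLayerFactorization e F r ε (C * (⌊1 / ε⌋₊ + 2)) := by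
  obtain ⟨C, hC⟩ := h
  refine ⟨C, fun ε hε => ?_⟩
  obtain ⟨Φ, hΦ, hΦF⟩ := hC (⌊1 / ε⌋₊ + 2) (by omega)
  have hfl : 1 / ε < (⌊1 / ε⌋₊ : ℝ) + 1 := Nat.lt_floor_add_one _
  have h0 : (0 : ℝ) ≤ (⌊1 / ε⌋₊ : ℝ) := Nat.cast_nonneg _
  obtain ⟨H, B, hH, hΦH⟩ := hΦ.exists_layerComp (ε := ε) (by positivity)
    (by
      push_cast
      rw [div_lt_one (by positivity)]
      linarith)
    (by
      push_cast
      rw [div_lt_comm₀ (by positivity) hε]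
      linarith)
  exact ⟨A₀, H, B, hA₀, hH, fun x hx => by rw [hΦF x hx, hΦH]⟩

lemma isBigO_mul_floor_inv (C : ℕ) :
    (fun ε : ℝ => ((C * (⌊1 / ε⌋₊ + 2) : ℕ) : ℝ)) =O[𝓝[>] (0 : ℝ)] fun ε : ℝ => ε ^ (-2 : ℤ) := by
  refine IsBigO.of_bound (3 * C) ?_
  filter_upwards [Ioc_mem_nhdsGT (zero_lt_one (α := ℝ))] with ε hε
  obtain ⟨hε0, hε1⟩ := hε
  have h1 : (⌊1 / ε⌋₊ : ℝ) ≤ 1 / ε := Nat.floor_le (by positivity)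
  have h2 : 1 ≤ 1 / ε := (one_le_div hε0).2 hε1
  have h3 : ε ^ (-2 : ℤ) = (1 / ε) * (1 / ε) := by
    rw [zpow_neg]
    simp [zpow_ofNat, sq]
  rw [h3, Real.norm_of_nonneg (by positivity), Real.norm_of_nonneg (by positivity)]
  push_cast
  have h4 : (⌊1 / ε⌋₊ : ℝ) + 2 ≤ 3 * (1 / ε * (1 / ε)) := by nlinarith
  calc (C : ℝ) * (⌊1 / ε⌋₊ + 2) ≤ C * (3 * (1 / ε * (1 / ε))) := by gcongr
    _ = 3 * C * (1 / ε * (1 / ε)) := by ring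

lemma lower_bound_fderiv_zero {T₁ T₂ : X →L[ℝ] X} {G : X → X} (hG : ContDiff ℝ 1 G) {c : ℝ}
    (hlow : ∀ w v v', c * ‖v - v'‖ ≤ ‖(v + T₂ (G (w + T₁ v))) - (v' + T₂ (G (w + T₁ v')))‖)
    (x : X) : c * ‖x‖ ≤ ‖x + T₂ (fderiv ℝ G 0 (T₁ x))‖ := by
  have hd : HasFDerivAt (fun v => v + T₂ (G (0 + T₁ v)))
      (ContinuousLinearMap.id ℝ X + T₂ ∘L fderiv ℝ G 0 ∘L T₁) 0 := by
    refine (hasFDerivAt_id 0).add (T₂.hasFDerivAt.comp 0 ?_)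
    have h2 : HasFDerivAt G (fderiv ℝ G (0 + T₁ 0)) (0 + T₁ 0) :=
      (hG.differentiable (by simp)).differentiableAt.hasFDerivAt
    simpa [Function.comp_def] using h2.comp (0 : X) (T₁.hasFDerivAt.const_add 0)
  exact hd.lower_bound (hlow 0) x

variable [CompleteSpace X]

/-- The lower bound of a layer persists for all its translates, once `G` is made to factor through
the closure of the range of `T₁`. -/
lemma exists_lower_bound_representation {T₁ T₂ : X →L[ℝ] X} {G : X → X} (hG : ContDiff ℝ 1 G)
    {c : ℝ} (hlow : ∀ x y, c * ‖x - y‖ ≤ ‖(x + T₂ (G (T₁ x))) - (y + T₂ (G (T₁ y)))‖) :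
    ∃ G' : X → X, ContDiff ℝ 1 G' ∧ (∀ x, G' (T₁ x) = G (T₁ x)) ∧
      ∀ w v v', c * ‖v - v'‖ ≤
        ‖(v + T₂ (G' (w + T₁ v))) - (v' + T₂ (G' (w + T₁ v')))‖ := by
  let Y : Submodule ℝ X := (LinearMap.range (T₁ : X →ₗ[ℝ] X)).topologicalClosure
  have hYc : IsClosed (Y : Set X) := Submodule.isClosed_topologicalClosure _
  have : CompleteSpace Y := hYc.completeSpace_coe
  have hTY : ∀ x, T₁ x ∈ Y := fun x => Submodule.le_topologicalClosure _ ⟨x, rfl⟩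
  have hP : ∀ x, Y.starProjection (T₁ x) = T₁ x := fun x =>
    Submodule.starProjection_eq_self_iff.2 (hTY x)
  refine ⟨fun z => G (Y.starProjection z), hG.comp Y.starProjection.contDiff,
    fun x => by simp only [hP], fun w v v' => ?_⟩
  simp only [map_add, hP]
  have hw : Y.starProjection w ∈ closure (Set.range T₁) := by
    have h1 : Y.starProjection w ∈ (Y : Set X) := Submodule.starProjection_apply_mem Y w
    rw [Submodule.topologicalClosure_coe] at h1
    exact h1
  generalize Y.starProjection w = p at hw
  have hGc := hG.continuous
  have hclosed : IsClosed {p : X | c * ‖v - v'‖ ≤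
      ‖(v + T₂ (G (p + T₁ v))) - (v' + T₂ (G (p + T₁ v')))‖} :=
    isClosed_le continuous_const (by fun_prop)
  refine closure_minimal ?_ hclosed hw
  rintro _ ⟨y, rfl⟩
  -- Translating by `T₁ y` amounts to shifting the arguments of the layer by `y`; other points of
  -- the closure follow by continuity.
  have h1 := hlow (y + v) (y + v')
  rw [map_add, map_add, add_sub_add_left_eq_sub] at h1
  have e1 : y + v + T₂ (G (T₁ y + T₁ v)) - (y + v' + T₂ (G (T₁ y + T₁ v'))) =
      (v + T₂ (G (T₁ y + T₁ v))) - (v' + T₂ (G (T₁ y + T₁ v'))) := by abel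
  rwa [e1] at h1

/-- The path `t ↦ (G (t z) - G 0) / t` from the derivative of `G` at `0` to `G - G 0`. -/
lemma reachable_fderiv_zero {T₁ T₂ : X →L[ℝ] X} (hT₁ : IsCompactOperator T₁)
    (hT₂ : IsCompactOperator T₂) {G : X → X} (hG : ContDiff ℝ 1 G) {c : ℝ} (hc : 0 < c)
    (hlow : ∀ w v v', c * ‖v - v'‖ ≤ ‖(v + T₂ (G (w + T₁ v))) - (v' + T₂ (G (w + T₁ v')))‖)
    (r : ℝ) :
    Reachable (Metric.ball 0 r) (fun x => x + T₂ (fderiv ℝ G 0 (T₁ x)))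
      (fun x => x + T₂ (G (T₁ x) - G 0)) := by
  let Γ : ℝ → X → X := fun t z => if t = 0 then fderiv ℝ G 0 z else t⁻¹ • (G (t • z) - G 0)
  have hΓ0 : ∀ z, Γ 0 z = fderiv ℝ G 0 z := fun z => if_pos rfl
  have hΓt : ∀ t ≠ 0, Γ t = fun z => t⁻¹ • (G (t • z) - G 0) := fun t ht => by
    funext z
    exact if_neg ht
  have hdiff : ∀ z, HasFDerivAt G (fderiv ℝ G z) z := fun z =>
    (hG.differentiable (by simp)).differentiableAt.hasFDerivAt
  -- The formula covers `t = 0` too, so the derivative is jointly continuous despite the quotient.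
  have hder : ∀ t z, HasFDerivAt (Γ t) (fderiv ℝ G (t • z)) z := by
    intro t z
    rcases eq_or_ne t 0 with rfl | ht
    · rw [show Γ 0 = fderiv ℝ G 0 from funext hΓ0, zero_smul]
      exact (fderiv ℝ G 0).hasFDerivAt
    · rw [hΓt t ht]
      have h1 : HasFDerivAt (fun z : X => t • z) (t • ContinuousLinearMap.id ℝ X) z :=
        (hasFDerivAt_id z).const_smul t
      have h2 := (((hdiff (t • z)).comp z h1).sub_const (G 0)).const_smul t⁻¹
      rw [ContinuousLinearMap.comp_smul, ContinuousLinearMap.comp_id, smul_smul,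
        inv_mul_cancel₀ ht, one_smul] at h2
      exact h2
  have hcont : Continuous fun p : ℝ × X => fderiv ℝ G (p.1 • p.2) :=
    (hG.continuous_fderiv (by simp)).comp (continuous_fst.smul continuous_snd)
  have hΓC : ∀ t, ContDiff ℝ 1 (Γ t) := fun t =>
    contDiff_one_iff_hasFDerivAt.2 ⟨_, hcont.comp (continuous_const.prodMk continuous_id), hder t⟩
  have hpath := reachable_of_path hT₁ hT₂ hΓC (fun t => ?_) (by
    simp only [fun t z => (hder t z).fderiv]
    exact hcont) (fun t => ⟨c, hc, ?_⟩) r 0 1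
  · refine hpath.congr (fun x _ => by rw [hΓ0]) fun x _ => ?_
    rw [hΓt 1 one_ne_zero]
    simp
  · rcases eq_or_ne t 0 with rfl | ht
    · simp [hΓ0]
    · simp [hΓt t ht]
  · rcases eq_or_ne t 0 with rfl | ht
    · intro w v v'
      have h2 := lower_bound_fderiv_zero hG hlow (v - v')
      convert h2 using 2
      simp only [hΓ0, map_add, map_sub]
      abel
    · intro w v v'
      have h1 := hlow (t • w) (t • v) (t • v')
      have e1 : (t • v + T₂ (G (t • w + T₁ (t • v)))) - (t • v' + T₂ (G (t • w + T₁ (t • v')))) =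
          t • ((v + T₂ (Γ t (w + T₁ v))) - (v' + T₂ (Γ t (w + T₁ v')))) := by
        simp only [hΓt t ht, map_smul, map_sub, smul_add, smul_sub, smul_smul,
          mul_inv_cancel₀ ht, one_smul]
        abel
      rw [e1, ← smul_sub, norm_smul, norm_smul, mul_left_comm] at h1
      exact le_of_mul_le_mul_left h1 (norm_pos_iff.2 ht)

/-- Restores the constant `T₂ (G 0)` removed to make the path vanish at `0`. -/
lemma reachable_add_const {T : X →L[ℝ] X} (hT : IsCompactOperator T) (g : X) (S : Set X)
    (f : X → X) : Reachable S f (fun x => f x + T g) := by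
  have hB : ElementaryLayer (1 / 2) (fun _ : X => T g) :=
    ⟨T, T, fun _ => g, hT, hT, contDiff_const, ⟨‖g‖₊, fun _ => by simp,
      (LipschitzWith.const g).weaken (zero_le (a := ‖g‖₊))⟩,
      fun w u => by simp, fun _ => rfl⟩
  exact (hB.reachable Set.univ).precomp (h := f) fun _ _ => Set.mem_univ _

/-- A neural operator layer with a lower Lipschitz bound is reachable from the identity or from a
given reflection. -/
lemma NeuralOperatorLayer.reachable {F : X → X} (hF : NeuralOperatorLayer F) {c : ℝ} (hc : 0 < c)
    (hlow : ∀ x y, c * ‖x - y‖ ≤ ‖F x - F y‖) {e : X} {χ : X →L[ℝ] ℝ} (hχ : χ e = -2) (r : ℝ) :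
    Reachable (Metric.ball 0 r) id F ∨ Reachable (Metric.ball 0 r) (rankOneUpdate e χ) F := by
  obtain ⟨T₁, T₂, G₀, hT₁, hT₂, hG₀, hF⟩ := hF
  obtain ⟨G, hG, hGG, hlow'⟩ := exists_lower_bound_representation (T₁ := T₁) (T₂ := T₂) hG₀
    fun x y => by rw [← hF, ← hF]; exact hlow x y
  have hFG : ∀ x, F x = x + T₂ (G (T₁ x) - G 0) + T₂ (G 0) := fun x => by
    rw [hF, ← hGG, map_sub]
    abel
  have h1 := reachable_fderiv_zero hT₁ hT₂ hG hc hlow' r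
  have h2 := (reachable_add_const hT₂ (G 0) (Metric.ball 0 r)
    (fun x => x + T₂ (G (T₁ x) - G 0))).congr (fun _ _ => rfl) (g' := F) fun x _ => hFG x
  have h3 := lower_bound_fderiv_zero hG hlow'
  rcases reachable_linear hT₁ hT₂ _ hc h3 hχ with h | h
  · exact Or.inl (((h r).trans h1).trans h2)
  · exact Or.inr (((h r).trans h1).trans h2)

end

theorem mainTheorem4 {X : Type*} [NormedAddCommGroup X] [InnerProductSpace ℝ X] [CompleteSpace X]
    [Nontrivial X] :
    ∃ e : X, ‖e‖ = 1 ∧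
      ∀ F : X → X, NeuralOperatorLayer F → BilipschitzMap F →
        ∀ r₁ : ℝ, 0 < r₁ →
          ∃ J : ℝ → ℕ,
            (∀ ε : ℝ, 0 < ε → HasLayerFactorization e F r₁ ε (J ε)) ∧
            (ContDiff ℝ 2 F →
              (fun ε : ℝ => (J ε : ℝ)) =O[𝓝[>] (0 : ℝ)] (fun ε : ℝ => ε ^ (-2 : ℤ))) := by
  obtain ⟨e, he⟩ := exists_norm_eq X (zero_le_one (α := ℝ))
  refine ⟨e, he, fun F hF ⟨c, _, hc, hFc⟩ r _ => ?_⟩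
  -- With this functional and `‖e‖ = 1`, the rank one update is the reflection of the statement.
  let χ : X →L[ℝ] ℝ := (-2 : ℝ) • innerSL ℝ e
  have hχ : χ e = -2 := by simp [χ, he]
  suffices h : ∃ C : ℕ, ∀ ε : ℝ, 0 < ε → HasLayerFactorization e F r ε (C * (⌊1 / ε⌋₊ + 2)) by
    obtain ⟨C, hC⟩ := h
    exact ⟨_, hC, fun _ => isBigO_mul_floor_inv C⟩
  rcases hF.reachable hc (fun x y => (hFc x y).1) hχ r with h | h
  · exact h.hasLayerFactorization (ContinuousLinearEquiv.refl ℝ X) (Or.inl fun _ => rfl)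
  · have hinv : ∀ x, rankOneUpdate e χ (rankOneUpdate e χ x) = x := fun x =>
      congrArg (fun A => A x) (rankOneUpdate_comp_self hχ)
    refine h.hasLayerFactorization
      (ContinuousLinearEquiv.equivOfInverse (rankOneUpdate e χ) (rankOneUpdate e χ) hinv hinv)
      (Or.inr fun x => ?_)
    rw [ContinuousLinearEquiv.equivOfInverse_apply, rankOneUpdate_apply, real_inner_comm]
    simp only [χ, smul_apply, innerSL_apply_apply, smul_eq_mul]
    module
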